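/- Let $n\ge 1$, and let $\mathcal Z$ be the commutative ring generated by $z_{i,a}, z_{\bar i,a}$ ($0\le i\le n$, $a\in\mathbb C$) with relations $z_{0,a}=z_{\bar 0,a}=1$ and $z_{i,a}z_{\bar i,a-2n+2i-4}=z_{i-1,a}z_{\overline{i-1},a-2n+2i-4}$ ($1\le i\le n$). **Paths.** A path is a lattice path in $\mathbb Z^2$ with unit E- and N-steps from a point of height $-n-1$ to a point of height $n+1$ (height $=$ second coordinate), with no E-steps at heights $\pm(n+1)$ and an even number of E-steps at height $0$. An E-step starting at $(x,y)$ has the label $n+1+y$ if $y<0$ and $\overline{n+1-y}$ if $y>0$; at height $0$ the E-steps are labelled, from left to right, alternately $\bar n,n,\bar n,n,\dots$. For $a\in\mathbb C$, the weight of a path is the product in $\mathcal Z$, over its E-steps, of $z_{L,a+2x}$, where $L$ is the label and $(x,y)$ the starting point of the step. Two paths that have a common point are *specially intersecting* if they meet only at height $0$ and the horizontal positions of their leftmost points at height $0$ differ by an odd number; otherwise they are *ordinarily intersecting*. **Tuples.** Let $\lambda/\mu$ be a skew diagram all of whose columns have length at most $n+1$, and let $l$ be the number of nonzero parts of $\lambda$.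 Consider all tuples $p=(p_1,\dots,p_l)$ of paths such that, for a (necessarily unique) permutation $\sigma\in\mathfrak S_l$, $p_i$ goes from $(\mu_i+1-i,-n-1)$ to $(\lambda_{\sigma(i)}+1-\sigma(i),n+1)$. The weight $z_a^p$ is the product of the weights of the $p_i$, and $(-1)^p=\operatorname{sgn}\sigma$. Let $P_1(\lambda/\mu)$ be the set of those $p$ without ordinarily intersecting pairs. **Units.** For $p\in P_1(\lambda/\mu)$, let $\alpha_i$ be the part of $p_i$ below height $0$ and $\beta_i$ the part of $p_{\sigma^{-1}(i)}$ above height $0$ (so that $\beta_i$ ends at $(\lambda_i+1-i,n+1)$), the E-steps at height $0$ being removed. For $0\le r\le n$, let $\alpha_i(-r)$ be the horizontal position of the leftmost point of $\alpha_i$ at height $-r$, and $\beta_i(r)$ that of the rightmost point of $\beta_i$ at height $r$; put $\alpha_0(-r)=+\infty$, $\beta_{l+1}(r)=-\infty$. Set $\alpha_i^*(r)=\alpha_{i-r}(-r)-1-r$ if $i-r\ge1$ and $+\infty$ otherwise, and $\beta_i^*(-r)=\beta_{i+r}(r)+1+r$ if $i+r\le l$ and $-\infty$ otherwise. A unit is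 a lattice unit square in $S_+=\mathbb R\times[0,n+1]$ or $S_-=\mathbb R\times[-n-1,0]$; its height is that of its lower edge if it lies in $S_+$ and that of its upper edge if it lies in $S_-$. Let $U$ be a unit of height $\pm r$ in $S_\pm$ with left edge at horizontal position $x$. - $U$ is a *I-unit* if for some $0\le i\le l$: $\alpha_i^*(r)\le x<x+1\le\beta_{i+1}(r)$ if $U\subset S_+$, resp. $\alpha_i(-r)\le x<x+1\le\beta^*_{i+1}(-r)$ if $U\subset S_-$. - $U$ is a *II-unit* if for some $0\le i\le l$: $\beta_{i+1}(r)\le x<x+1\le\alpha_i^*(r)$ if $U\subset S_+$, resp. $\beta^*_{i+1}(-r)\le x<x+1\le\alpha_i(-r)$ if $U\subset S_-$. It is a *boundary* II-unit if moreover, for such an $i$, one has $i\le r$, $i=l$ or $r=n$ (if $U\subset S_+$), resp. $i=0$, $i\ge l-r$ or $r=n$ (if $U\subset S_-$). **Regions.** Two units are adjacent if the upper left or the lower right vertex of one is a vertex of the other. A *I-region* is a connected component, with respect to the equivalence relation generated by adjacency, of the set of I-units that contains a I-unit of height $0$. A *II-region* is a connected component of the set of II-units that contains a II-unit of height $0$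 and no boundary II-unit. For $1\le i<l$, the pair $(\alpha_i,\beta_{i+1})$ is an *overlap* if $h=\alpha_i(0)-\beta_{i+1}(0)\le0$ and a *hole* if $h>0$; it is even if $h$ is even. A I-region (resp. II-region) $V$ is *odd* if the number of $i$ such that $(\alpha_i,\beta_{i+1})$ is an even overlap (resp. even hole) which meets $V$ at height $0$ is odd; here $(\alpha_i,\beta_{i+1})$ meets $V$ at height $0$ if $V$ contains a unit of height $0$ that satisfies the above I-unit (resp. II-unit) inequalities for this $i$. Let $P_{\mathrm{odd}}(\lambda/\mu)$ be the set of all $p\in P_1(\lambda/\mu)$ which have at least one odd I- or II-region. **Proposition.** There exists a weight-preserving, sign-reversing involution on $P_{\mathrm{odd}}(\lambda/\mu)$: a map $\iota_2:P_{\mathrm{odd}}(\lambda/\mu)\to P_{\mathrm{odd}}(\lambda/\mu)$ with $\iota_2\circ\iota_2=\mathrm{id}$, $z_a^{\iota_2(p)}=z_a^{p}$ for all $a\in\mathbb C$, and $(-1)^{\iota_2(p)}=-(-1)^p$ for all $p\in P_{\mathrm{odd}}(\lambda/\mu)$. -/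

import Mathlib

open Finset

noncomputable section

namespace TypeC

/-! ### The ring of weights -/

/-- Indices of the generators: `(false, i)` stands for `i` and `(true, i)` for `i` with a bar,
where `i = 0, …, n`. -/
abbrev Letter (n : ℕ) : Type := Bool × Fin (n + 1)

/-- The relations
`z_{i,a} z_{ī,a-2n+2i-4} = z_{i-1,a} z_{\overline{i-1},a-2n+2i-4}` (`i = 1, …, n`) and
`z_{0,a} = z_{\bar 0,a} = 1`. In the first set `j : Fin n` stands for `i = j + 1`. -/
def relations (n : ℕ) : Set (MvPolynomial (Letter n × ℂ) ℤ) :=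
  {f | ∃ (j : Fin n) (a a' : ℂ), a' = a - 2 * (n : ℂ) + 2 * ((j : ℕ) + 1 : ℂ) - 4 ∧
      f = MvPolynomial.X ((false, j.succ), a) * MvPolynomial.X ((true, j.succ), a')
        - MvPolynomial.X ((false, j.castSucc), a) * MvPolynomial.X ((true, j.castSucc), a')} ∪
  {f | ∃ (s : Bool) (a : ℂ), f = MvPolynomial.X ((s, 0), a) - 1}

/-- The commutative ring generated by the `z_{i,a}` with the relations above. -/
abbrev ZRing (n : ℕ) : Type :=
  MvPolynomial (Letter n × ℂ) ℤ ⧸ Ideal.span (relations n)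

/-- The generator `z_{i,a}`. -/
def z {n : ℕ} (i : Letter n) (a : ℂ) : ZRing n :=
  Ideal.Quotient.mk (Ideal.span (relations n)) (MvPolynomial.X (i, a))

/-! ### Lattice paths -/

/-- A lattice path with unit E-steps and N-steps from height `b` to height `t` having no E-step
at the heights `b` and `t`. It is recorded by the horizontal position of its initial point and
by the number of its E-steps at each height. -/
@[ext]
structure LatticePath (b t : ℤ) where
  /-- horizontal position of the initial point -/
  start : ℤ
  /-- `east y` is the number of E-steps at height `y` -/
  east : ℤ → ℕ
  east_eq_zero : ∀ y, ¬ (b < y ∧ y < t) → east y = 0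

namespace LatticePath

variable {b t : ℤ}

/-- Horizontal position of the leftmost point of the path at height `y`. -/
def left (p : LatticePath b t) (y : ℤ) : ℤ := p.start + ∑ h ∈ Ico b y, (p.east h : ℤ)

/-- Horizontal position of the rightmost point of the path at height `y`. -/
def right (p : LatticePath b t) (y : ℤ) : ℤ := p.left y + p.east y

/-- The path passes through the lattice point `(x, y)`. -/
def Passes (p : LatticePath b t) (x y : ℤ) : Prop :=
  b ≤ y ∧ y ≤ t ∧ p.left y ≤ x ∧ x ≤ p.right y

/-- The paths have a common point. -/
def Intersects (p q : LatticePath b t) : Prop := ∃ x y, p.Passes x y ∧ q.Passes x y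

end LatticePath

/-- A path of type `C_n`: from height `-n-1` to height `n+1`, no E-steps at heights `±(n+1)`, and
an even number of E-steps at height `0`. -/
@[ext]
structure CPath (n : ℕ) extends LatticePath (-(n : ℤ) - 1) ((n : ℤ) + 1) where
  even_east : Even (east 0)

/-- A lower path: from height `-n-1` to height `0`, no E-steps at these two heights. -/
abbrev LowerPath (n : ℕ) : Type := LatticePath (-(n : ℤ) - 1) 0

/-- An upper path: from height `0` to height `n+1`, no E-steps at these two heights. -/
abbrev UpperPath (n : ℕ) : Type := LatticePath 0 ((n : ℤ) + 1)

namespace CPath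

variable {n : ℕ}

/-- The first component of the `h`-labeling, for the E-step number `k` (counted from `0`, from left
to right) at height `y`: it is `n+1+y` if `y < 0`, `\overline{n+1-y}` if `y > 0`, and at height `0`
the labels are alternately `\bar n, n, \bar n, n, …`. -/
def label (n : ℕ) (y : ℤ) (k : ℕ) : Letter n :=
  if y < 0 then (false, Fin.ofNat (n + 1) (n + 1 - y.natAbs))
  else if y = 0 then (if Odd k then (false, Fin.last n) else (true, Fin.last n))
  else (true, Fin.ofNat (n + 1) (n + 1 - y.natAbs))

/-- The weight of a path: the product over all its E-steps, those at height `y` starting at the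
points `(left y + k, y)`, `0 ≤ k < east y`. -/
def weight (p : CPath n) (a : ℂ) : ZRing n :=
  ∏ y ∈ Icc (-(n : ℤ)) (n : ℤ), ∏ k ∈ range (p.east y),
    z (label n y k) (a + 2 * ((p.left y + (k : ℤ) : ℤ) : ℂ))

/-- `p` and `q` are specially intersecting: they intersect, only at height `0`, and
`p(0) - q(0)` is odd. -/
def SpeciallyIntersecting (p q : CPath n) : Prop :=
  p.Intersects q.toLatticePath ∧
  (∀ x y, p.Passes x y → q.Passes x y → y = 0) ∧ Odd (p.left 0 - q.left 0)

/-- `p` and `q` intersect, but not specially. -/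
def OrdinarilyIntersecting (p q : CPath n) : Prop :=
  p.Intersects q.toLatticePath ∧ ¬ SpeciallyIntersecting p q

/-- The part of a path below height `0`, as a lower path. -/
def lowerPart (p : CPath n) : LowerPath n where
  start := p.start
  east y := if y < 0 then p.east y else 0
  east_eq_zero y hy := by
    split_ifs with h
    · exact p.east_eq_zero y (by omega)
    · rfl

/-- The part of a path above height `0`, as an upper path. -/
def upperPart (p : CPath n) : UpperPath n where
  start := p.right 0
  east y := if 0 < y then p.east y else 0
  east_eq_zero y hy := by
    split_ifs with h
    · exact p.east_eq_zero y (by omega)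
    · rfl

end CPath

/-! ### Skew diagrams and tuples of paths -/

/-- The depth of the skew diagram `lam/mu`: the maximal length of its columns. -/
def depth (lam mu : YoungDiagram) : ℕ :=
  (range (lam.rowLen 0)).sup fun j => lam.colLen j - mu.colLen j

/-- A tuple of paths `p = (p_1, …, p_l)`, `l` the length of `lam`, together with a permutation `σ`
such that `p_i` goes from `(μ_i + 1 - i, -n-1)` to `(λ_{σ(i)} + 1 - σ(i), n+1)`.
Rows are numbered from `0` here, whence `μ_i - i` and `λ_{σ(i)} - σ(i)`. -/
structure PathTuple (n : ℕ) (lam mu : YoungDiagram) where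
  perm : Equiv.Perm (Fin (lam.colLen 0))
  path : Fin (lam.colLen 0) → CPath n
  start_eq : ∀ i, (path i).start = (mu.rowLen i : ℤ) - (i : ℕ)
  end_eq : ∀ i, (path i).right ((n : ℤ) + 1) = (lam.rowLen (perm i) : ℤ) - (perm i : ℕ)

/-- A pair `(α; β)` of an `l`-tuple of lower paths and an `l`-tuple of upper paths. -/
structure HalfPaths (n l : ℕ) where
  lower : Fin l → LowerPath n
  upper : Fin l → UpperPath n

namespace PathTuple

variable {n : ℕ} {lam mu : YoungDiagram}

/-- The weight of a tuple of paths. -/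
def weight (p : PathTuple n lam mu) (a : ℂ) : ZRing n := ∏ i, (p.path i).weight a

/-- The sign of a tuple of paths. -/
def sign (p : PathTuple n lam mu) : ℤˣ := Equiv.Perm.sign p.perm

/-- No two of the paths are ordinarily intersecting. -/
def NoOrdinary (p : PathTuple n lam mu) : Prop :=
  ∀ i j, i ≠ j → ¬ CPath.OrdinarilyIntersecting (p.path i) (p.path j)

/-- The pair `(α; β)` obtained by removing the E-steps at height `0`. As `α_i` starts at
`(μ_i + 1 - i, -n-1)` and `β_i` ends at `(λ_i + 1 - i, n+1)`, the upper path `β_i` is the upper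
part of `p_{σ⁻¹(i)}`. -/
def toHalfPaths (p : PathTuple n lam mu) : HalfPaths n (lam.colLen 0) where
  lower i := (p.path i).lowerPart
  upper i := (p.path (p.perm.symm i)).upperPart

end PathTuple

/-! ### Units -/

/-- Unit squares with lattice vertices: `upper x r` has lower edge from `(x, r)` to `(x+1, r)`;
`lower x r` has upper edge from `(x, -r)` to `(x+1, -r)`. Their heights are `r` and `-r`. -/
inductive LatticeUnit : Type
  | upper (x : ℤ) (r : ℕ)
  | lower (x : ℤ) (r : ℕ)

namespace LatticeUnit

/-- The height of a unit. -/
def height : LatticeUnit → ℤ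
  | upper _ r => r
  | lower _ r => -(r : ℤ)

/-- The lower left vertex. -/
def corner : LatticeUnit → ℤ × ℤ
  | upper x r => (x, (r : ℤ))
  | lower x r => (x, -(r : ℤ) - 1)

/-- The four vertices. -/
def vertices (U : LatticeUnit) : Set (ℤ × ℤ) :=
  {U.corner, U.corner + (1, 0), U.corner + (0, 1), U.corner + (1, 1)}

/-- `U ◇ U'`: the upper left or the lower right vertex of `U` is a vertex of `U'`. -/
def Adjacent (U U' : LatticeUnit) : Prop :=
  U.corner + (0, 1) ∈ U'.vertices ∨ U.corner + (1, 0) ∈ U'.vertices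

end LatticeUnit

/-- `V` is a connected component of the set `S` of units, with respect to the equivalence relation
on `S` generated by adjacency. A union of units is identified with the set of these units. -/
def IsComponent (S V : Set LatticeUnit) : Prop :=
  ∃ U : S, V = Subtype.val ''
    {U' : S | Relation.EqvGen (fun A B : S => LatticeUnit.Adjacent A B) U U'}

/-! ### Regions

In this section the members of the tuples `α`, `β` are numbered `1, …, l`. -/

namespace HalfPaths

variable {n l : ℕ}

/-- `α_i(-r)`, equal to `+∞` for `i` outside `1, …, l`. -/
def alpha (q : HalfPaths n l) (i r : ℕ) : WithTop ℤ :=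
  if h : 1 ≤ i ∧ i ≤ l then (((q.lower ⟨i - 1, by omega⟩).left (-(r : ℤ)) : ℤ) : WithTop ℤ) else ⊤

/-- `β_i(r)`, equal to `-∞` for `i` outside `1, …, l`. -/
def beta (q : HalfPaths n l) (i r : ℕ) : WithBot ℤ :=
  if h : 1 ≤ i ∧ i ≤ l then (((q.upper ⟨i - 1, by omega⟩).right (r : ℤ) : ℤ) : WithBot ℤ) else ⊥

/-- `α*_i(r) = α_{i-r}(-r) - 1 - r`, equal to `+∞` if `i - r ≤ 0`. -/
def alphaDual (q : HalfPaths n l) (i r : ℕ) : WithTop ℤ :=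
  if r < i then (q.alpha (i - r) r).map (fun x => x - 1 - (r : ℤ)) else ⊤

/-- `β*_i(-r) = β_{i+r}(r) + 1 + r`, equal to `-∞` if `i + r ≥ l + 1`. -/
def betaDual (q : HalfPaths n l) (i r : ℕ) : WithBot ℤ :=
  if i + r ≤ l then (q.beta (i + r) r).map (fun x => x + 1 + (r : ℤ)) else ⊥

/-- The inequalities defining a I-unit, for the index `i`. -/
def IUnitAt (q : HalfPaths n l) (i : ℕ) : LatticeUnit → Prop
  | .upper x r => r ≤ n ∧ q.alphaDual i r ≤ (x : WithTop ℤ) ∧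
      ((x + 1 : ℤ) : WithBot ℤ) ≤ q.beta (i + 1) r
  | .lower x r => r ≤ n ∧ q.alpha i r ≤ (x : WithTop ℤ) ∧
      ((x + 1 : ℤ) : WithBot ℤ) ≤ q.betaDual (i + 1) r

/-- The inequalities defining a II-unit, for the index `i`. -/
def IIUnitAt (q : HalfPaths n l) (i : ℕ) : LatticeUnit → Prop
  | .upper x r => r ≤ n ∧ q.beta (i + 1) r ≤ (x : WithBot ℤ) ∧
      ((x + 1 : ℤ) : WithTop ℤ) ≤ q.alphaDual i r
  | .lower x r => r ≤ n ∧ q.betaDual (i + 1) r ≤ (x : WithBot ℤ) ∧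
      ((x + 1 : ℤ) : WithTop ℤ) ≤ q.alpha i r

/-- The set of I-units. -/
def iUnits (q : HalfPaths n l) : Set LatticeUnit := {U | ∃ i ≤ l, q.IUnitAt i U}

/-- The set of II-units. -/
def iiUnits (q : HalfPaths n l) : Set LatticeUnit := {U | ∃ i ≤ l, q.IIUnitAt i U}

/-- Boundary II-units. -/
def IsBoundary (q : HalfPaths n l) : LatticeUnit → Prop
  | .upper x r => ∃ i ≤ l, q.IIUnitAt i (.upper x r) ∧ (i ≤ r ∨ i = l ∨ r = n)
  | .lower x r => ∃ i ≤ l, q.IIUnitAt i (.lower x r) ∧ (i = 0 ∨ l ≤ i + r ∨ r = n)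

/-- `V` is a I-region of `(α; β)`. -/
def IsIRegion (q : HalfPaths n l) (V : Set LatticeUnit) : Prop :=
  IsComponent q.iUnits V ∧ ∃ U ∈ V, U.height = 0

/-- `V` is a II-region of `(α; β)`. -/
def IsIIRegion (q : HalfPaths n l) (V : Set LatticeUnit) : Prop :=
  IsComponent q.iiUnits V ∧ (∃ U ∈ V, U.height = 0) ∧ ∀ U ∈ V, ¬ q.IsBoundary U

/-- The number `α_i(0) - β_{i+1}(0)`, for `1 ≤ i < l`. -/
def gap (q : HalfPaths n l) (i : ℕ) (h : 1 ≤ i ∧ i < l) : ℤ :=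
  (q.lower ⟨i - 1, by omega⟩).left 0 - (q.upper ⟨i, h.2⟩).right 0

/-- `n(V)` for a I-region `V`: the number of even overlaps `(α_i, β_{i+1})` meeting `V` at
height `0`, that is, such that some unit of height `0` between `α_i` and `β_{i+1}` lies in `V`. -/
def overlapCount (q : HalfPaths n l) (V : Set LatticeUnit) : ℕ :=
  Set.ncard {i : ℕ | ∃ h : 1 ≤ i ∧ i < l, q.gap i h ≤ 0 ∧ Even (q.gap i h) ∧
    ∃ U ∈ V, U.height = 0 ∧ q.IUnitAt i U}

/-- `n(V)` for a II-region `V`: the number of even holes `(α_i, β_{i+1})` meeting `V` at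
height `0`. -/
def holeCount (q : HalfPaths n l) (V : Set LatticeUnit) : ℕ :=
  Set.ncard {i : ℕ | ∃ h : 1 ≤ i ∧ i < l, 0 < q.gap i h ∧ Even (q.gap i h) ∧
    ∃ U ∈ V, U.height = 0 ∧ q.IIUnitAt i U}

/-- `(α; β)` has at least one odd I- or II-region. -/
def HasOddRegion (q : HalfPaths n l) : Prop :=
  (∃ V, q.IsIRegion V ∧ Odd (q.overlapCount V)) ∨ (∃ V, q.IsIIRegion V ∧ Odd (q.holeCount V))

end HalfPaths

/-- The set `P_1(lam/mu)` of all tuples without ordinarily intersecting pairs of paths. -/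
def P₁ (n : ℕ) (lam mu : YoungDiagram) : Set (PathTuple n lam mu) := {p | p.NoOrdinary}

/-- The set `P_odd(lam/mu)` of all elements of `P_1(lam/mu)` having at least one odd I- or
II-region. -/
def POdd (n : ℕ) (lam mu : YoungDiagram) : Set (PathTuple n lam mu) :=
  {p | p ∈ P₁ n lam mu ∧ p.toHalfPaths.HasOddRegion}

end TypeC

end

noncomputable section

namespace TypeC

/-! ### Adjacency and connected components of units -/

namespace LatticeUnit

theorem adjacent_iff (U U' : LatticeUnit) : U.Adjacent U' ↔
    (-1 ≤ U'.corner.1 - U.corner.1 ∧ U'.corner.1 - U.corner.1 ≤ 1) ∧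
    (-1 ≤ U'.corner.2 - U.corner.2 ∧ U'.corner.2 - U.corner.2 ≤ 1) ∧
    (-1 ≤ U'.corner.1 - U.corner.1 + (U'.corner.2 - U.corner.2) ∧
      U'.corner.1 - U.corner.1 + (U'.corner.2 - U.corner.2) ≤ 1) := by
  simp only [Adjacent, vertices, Set.mem_insert_iff, Set.mem_singleton_iff, Prod.ext_iff,
    Prod.fst_add, Prod.snd_add]
  omega

theorem Adjacent.symm {U U' : LatticeUnit} (h : U.Adjacent U') : U'.Adjacent U := by
  rw [adjacent_iff] at *
  omega

/-- The row `r` of a unit of height `±r`. -/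
def row : LatticeUnit → ℕ
  | upper _ r => r
  | lower _ r => r

/-- The horizontal position of the unit of `S_-` which is dual or equal to the given unit. -/
def col : LatticeUnit → ℤ
  | upper x r => x + r + 1
  | lower x _ => x

theorem Adjacent.col_row {U U' : LatticeUnit} (h : U.Adjacent U') :
    (-1 ≤ U'.col - U.col ∧ U'.col - U.col ≤ 1) ∧
    (-1 ≤ (U'.row : ℤ) - U.row ∧ (U'.row : ℤ) - U.row ≤ 1) ∧
    (-1 ≤ U'.col - U.col - ((U'.row : ℤ) - U.row) ∧
      U'.col - U.col - ((U'.row : ℤ) - U.row) ≤ 1) := by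
  rw [adjacent_iff] at h
  cases U <;> cases U' <;> simp only [corner, row, col] at * <;> omega

end LatticeUnit

/-- `W` is closed in `S` under adjacency. -/
def ClosedIn (W S : Set LatticeUnit) : Prop := ∀ U ∈ W, ∀ U' ∈ S, U.Adjacent U' → U' ∈ W

/-- `V` is nonempty and connected under adjacency. -/
def IsConn (V : Set LatticeUnit) : Prop :=
  V.Nonempty ∧ ∀ W ⊆ V, W.Nonempty → ClosedIn W V → W = V

theorem isComponent_iff (S V : Set LatticeUnit) :
    IsComponent S V ↔ IsConn V ∧ V ⊆ S ∧ ClosedIn V S := by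
  constructor
  · rintro ⟨U, rfl⟩
    have hcl : ClosedIn (Subtype.val '' {U' : S |
        Relation.EqvGen (fun A B : S => LatticeUnit.Adjacent A B) U U'}) S := by
      rintro _ ⟨A, hA, rfl⟩ B hB hAB
      exact ⟨⟨B, hB⟩, hA.trans _ _ _ (.rel _ _ hAB), rfl⟩
    refine ⟨⟨⟨U, U, .refl _, rfl⟩, fun W hW hne hcW => ?_⟩, ?_, hcl⟩
    · refine hW.antisymm ?_
      have key : ∀ A B : S, Relation.EqvGen (fun A B : S => LatticeUnit.Adjacent A B) A B →
          ((A : LatticeUnit) ∈ W ↔ (B : LatticeUnit) ∈ W) := by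
        intro A B h
        induction h with
        | rel A B h =>
          constructor
          · intro hA
            exact hcW _ hA _ (hcl _ (hW hA) _ B.2 h) h
          · intro hB
            exact hcW _ hB _ (hcl _ (hW hB) _ A.2 h.symm) h.symm
        | refl => rfl
        | symm _ _ _ ih => exact ih.symm
        | trans _ _ _ _ _ ih₁ ih₂ => exact ih₁.trans ih₂
      obtain ⟨A, hA⟩ := hne
      obtain ⟨A', hA', rfl⟩ := hW hA
      rintro _ ⟨B, hB, rfl⟩
      exact (key _ _ hB).1 ((key _ _ hA').2 hA)
    · rintro _ ⟨A, -, rfl⟩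
      exact A.2
  · rintro ⟨⟨⟨U, hU⟩, hmin⟩, hVS, hcl⟩
    refine ⟨⟨U, hVS hU⟩, ?_⟩
    symm
    have hcl' : ∀ A B : S, Relation.EqvGen (fun A B : S => LatticeUnit.Adjacent A B) A B →
        ((A : LatticeUnit) ∈ V ↔ (B : LatticeUnit) ∈ V) := by
      intro A B h
      induction h with
      | rel A B h => exact ⟨fun hA => hcl _ hA _ B.2 h, fun hB => hcl _ hB _ A.2 h.symm⟩
      | refl => rfl
      | symm _ _ _ ih => exact ih.symm
      | trans _ _ _ _ _ ih₁ ih₂ => exact ih₁.trans ih₂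
    refine hmin _ ?_ ⟨U, ⟨U, hVS hU⟩, .refl _, rfl⟩ ?_
    · rintro _ ⟨A, hA, rfl⟩
      exact (hcl' _ _ hA).1 hU
    · rintro _ ⟨A, hA, rfl⟩ B hB hAB
      exact ⟨⟨B, hVS hB⟩, hA.trans _ _ _ (.rel _ _ hAB), rfl⟩

/-! ### Noncrossing arrays -/

/-- Two arrays `A i r`, `B i r` (`1 ≤ i ≤ l`, `0 ≤ r ≤ n`), the positions of the lower and of the
upper paths, are noncrossing. -/
structure Noncrossing (n l : ℕ) (A B : ℕ → ℕ → ℤ) : Prop where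
  lo_mono : ∀ i r, 1 ≤ i → i ≤ l → r < n → A i (r + 1) ≤ A i r
  lo_lt : ∀ i r, 1 ≤ i → i + 1 ≤ l → r < n → A (i + 1) r < A i (r + 1)
  lo_last : ∀ i, 1 ≤ i → i + 1 ≤ l → A (i + 1) n < A i n
  up_mono : ∀ i r, 1 ≤ i → i ≤ l → r < n → B i r ≤ B i (r + 1)
  up_lt : ∀ i r, 1 ≤ i → i + 1 ≤ l → r < n → B (i + 1) (r + 1) < B i r
  up_last : ∀ i, 1 ≤ i → i + 1 ≤ l → B (i + 1) n < B i n
  dual_last : ∀ i, 1 ≤ i → i + 1 + n ≤ l → B (i + 1 + n) n + 1 + n ≤ A i n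

namespace Noncrossing

variable {n l : ℕ} {A B : ℕ → ℕ → ℤ}

theorem lo_succ_lt (h : Noncrossing n l A B) {i r : ℕ} (hi : 1 ≤ i) (hl : i + 1 ≤ l)
    (hr : r ≤ n) : A (i + 1) r < A i r := by
  rcases hr.lt_or_eq with hr | rfl
  · exact (h.lo_lt i r hi hl hr).trans_le (h.lo_mono i r hi (by omega) hr)
  · exact h.lo_last i hi hl

theorem up_succ_lt (h : Noncrossing n l A B) {i r : ℕ} (hi : 1 ≤ i) (hl : i + 1 ≤ l)
    (hr : r ≤ n) : B (i + 1) r < B i r := by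
  rcases hr.lt_or_eq with hr | rfl
  · exact (h.up_mono (i + 1) r (by omega) hl hr).trans_lt (h.up_lt i r hi hl hr)
  · exact h.up_last i hi hl

theorem lo_anti (h : Noncrossing n l A B) {r : ℕ} (hr : r ≤ n) {i k : ℕ} (hi : 1 ≤ i)
    (hik : i ≤ k) (hk : k ≤ l) : A k r + ((k : ℤ) - i) ≤ A i r := by
  induction k, hik using Nat.le_induction with
  | base => simp
  | succ k hik ih =>
    have := ih (by omega)
    have := h.lo_succ_lt (r := r) (i := k) (by omega) hk hr
    push_cast
    omega

theorem up_anti (h : Noncrossing n l A B) {r : ℕ} (hr : r ≤ n) {i k : ℕ} (hi : 1 ≤ i)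
    (hik : i ≤ k) (hk : k ≤ l) : B k r + ((k : ℤ) - i) ≤ B i r := by
  induction k, hik using Nat.le_induction with
  | base => simp
  | succ k hik ih =>
    have := ih (by omega)
    have := h.up_succ_lt (r := r) (i := k) (by omega) hk hr
    push_cast
    omega

/-- A I-unit and a II-unit are neither equal nor adjacent. -/
theorem not_adjacent (h : Noncrossing n l A B) {j k r r' : ℕ} {x x' : ℤ} (hr : r ≤ n)
    (hr' : r' ≤ n) (hj : 1 ≤ j) (hjl : j + 1 + r ≤ l) (hA : A j r ≤ x)
    (hB : x < B (j + 1 + r) r + 1 + r) (hk : k ≤ l)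
    (hB' : k + 1 + r' ≤ l → B (k + 1 + r') r' + 1 + r' ≤ x') (hA' : 1 ≤ k → x' < A k r')
    (hx : -1 ≤ x' - x ∧ x' - x ≤ 1) (hrr : -1 ≤ (r' : ℤ) - r ∧ (r' : ℤ) - r ≤ 1)
    (hd : -1 ≤ x' - x - ((r' : ℤ) - r) ∧ x' - x - ((r' : ℤ) - r) ≤ 1) : False := by
  have hcase : r' = r ∨ r' = r + 1 ∨ r = r' + 1 := by omega
  rcases hcase with rfl | rfl | rfl
  · rcases lt_trichotomy k j with hkj | rfl | hkj
    · have := hB' (by omega)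
      have := h.up_anti hr (i := k + 1 + r') (k := j + 1 + r') (by omega) (by omega) hjl
      omega
    · have := hB' hjl
      have := hA' hj
      omega
    · have := hA' (by omega)
      have := h.lo_anti hr hj hkj.le hk
      omega
  · by_cases hkj : k < j
    · have := hB' (by omega)
      have := h.up_anti hr' (i := k + 1 + (r + 1)) (k := j + 1 + r) (by omega) (by omega) hjl
      have := h.up_mono (j + 1 + r) r (by omega) hjl (by omega)
      push_cast at *
      omega
    · have := hA' (by omega)
      have := h.lo_anti hr' hj (not_lt.1 hkj) hk
      have := h.lo_mono j r hj (by omega) (by omega)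
      omega
  · by_cases hkj : k ≤ j
    · have := hB' (by omega)
      have := h.up_anti hr' (i := k + 1 + r') (k := j + 1 + r') (by omega) (by omega) (by omega)
      have := h.up_lt (j + 1 + r') r' (by omega) (by omega) (by omega)
      rw [show j + 1 + (r' + 1) = j + 1 + r' + 1 by ring] at hB
      push_cast at *
      omega
    · have := hA' (by omega)
      have := h.lo_anti hr' (i := j + 1) (k := k) (by omega) (by omega) hk
      have := h.lo_lt j r' hj (by omega) (by omega)
      omega

end Noncrossing

/-! ### Units in terms of the arrays -/

namespace HalfPaths

variable {n l : ℕ}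

/-- `α_i(-r)` as an integer (`0` for `i` outside `1, …, l`). -/
def lo (q : HalfPaths n l) (i r : ℕ) : ℤ :=
  if h : 1 ≤ i ∧ i ≤ l then (q.lower ⟨i - 1, by omega⟩).left (-(r : ℤ)) else 0

/-- `β_i(r)` as an integer (`0` for `i` outside `1, …, l`). -/
def up (q : HalfPaths n l) (i r : ℕ) : ℤ :=
  if h : 1 ≤ i ∧ i ≤ l then (q.upper ⟨i - 1, by omega⟩).right (r : ℤ) else 0

theorem alpha_eq (q : HalfPaths n l) {i r : ℕ} (hi : 1 ≤ i) (hl : i ≤ l) :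
    q.alpha i r = (q.lo i r : WithTop ℤ) := by
  simp [alpha, lo, hi, hl]

theorem beta_eq (q : HalfPaths n l) {i r : ℕ} (hi : 1 ≤ i) (hl : i ≤ l) :
    q.beta i r = (q.up i r : WithBot ℤ) := by
  simp [beta, up, hi, hl]

theorem iUnitAt_upper (q : HalfPaths n l) {i r : ℕ} {x : ℤ} (hi : i ≤ l) :
    q.IUnitAt i (.upper x r) ↔ r ≤ n ∧ r < i ∧ i < l ∧
      q.lo (i - r) r - 1 - r ≤ x ∧ x < q.up (i + 1) r := by
  by_cases h₁ : r < i
  · by_cases h₂ : i < l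
    · rw [IUnitAt, alphaDual, if_pos h₁, alpha_eq _ (by omega) (by omega),
        beta_eq _ (by omega) (by omega), WithTop.map_coe, WithTop.coe_le_coe, WithBot.coe_le_coe]
      simp only [h₁, h₂, true_and, Int.add_one_le_iff]
    · rw [IUnitAt, beta, dif_neg (by omega)]
      simp [h₂]
  · rw [IUnitAt, alphaDual, if_neg h₁]
    simp [h₁]

theorem iiUnitAt_upper (q : HalfPaths n l) {i r : ℕ} {x : ℤ} (hi : i ≤ l) :
    q.IIUnitAt i (.upper x r) ↔ r ≤ n ∧ (i < l → q.up (i + 1) r ≤ x) ∧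
      (r < i → x < q.lo (i - r) r - 1 - r) := by
  have h1 : q.beta (i + 1) r ≤ (x : WithBot ℤ) ↔ (i < l → q.up (i + 1) r ≤ x) := by
    by_cases h₂ : i < l
    · rw [beta_eq _ (by omega) (by omega), WithBot.coe_le_coe]
      simp [h₂]
    · rw [beta, dif_neg (by omega)]
      simp [h₂]
  have h2 : ((x + 1 : ℤ) : WithTop ℤ) ≤ q.alphaDual i r ↔
      (r < i → x < q.lo (i - r) r - 1 - r) := by
    by_cases h₁ : r < i
    · rw [alphaDual, if_pos h₁, alpha_eq _ (by omega) (by omega), WithTop.map_coe,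
        WithTop.coe_le_coe]
      simp only [h₁, true_imp_iff, Int.add_one_le_iff]
    · rw [alphaDual, if_neg h₁]
      simp [h₁]
  rw [IIUnitAt, h1, h2]

theorem iUnitAt_lower (q : HalfPaths n l) {i r : ℕ} {x : ℤ} (hi : i ≤ l) :
    q.IUnitAt i (.lower x r) ↔ r ≤ n ∧ 1 ≤ i ∧ i + 1 + r ≤ l ∧
      q.lo i r ≤ x ∧ x < q.up (i + 1 + r) r + 1 + r := by
  by_cases h₁ : 1 ≤ i
  · by_cases h₂ : i + 1 + r ≤ l
    · rw [IUnitAt, betaDual, if_pos h₂, alpha_eq _ (by omega) (by omega),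
        beta_eq _ (by omega) (by omega), WithBot.map_coe, WithTop.coe_le_coe, WithBot.coe_le_coe]
      simp only [h₁, h₂, true_and, Int.add_one_le_iff]
    · rw [IUnitAt, betaDual, if_neg h₂]
      simp [h₂]
  · rw [IUnitAt, alpha, dif_neg (by omega)]
    simp [h₁]

theorem iiUnitAt_lower (q : HalfPaths n l) {i r : ℕ} {x : ℤ} (hi : i ≤ l) :
    q.IIUnitAt i (.lower x r) ↔ r ≤ n ∧ (i + 1 + r ≤ l → q.up (i + 1 + r) r + 1 + r ≤ x) ∧
      (1 ≤ i → x < q.lo i r) := by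
  have h1 : q.betaDual (i + 1) r ≤ (x : WithBot ℤ) ↔
      (i + 1 + r ≤ l → q.up (i + 1 + r) r + 1 + r ≤ x) := by
    by_cases h₂ : i + 1 + r ≤ l
    · rw [betaDual, if_pos h₂, beta_eq _ (by omega) (by omega), WithBot.map_coe,
        WithBot.coe_le_coe]
      simp [h₂]
    · rw [betaDual, if_neg h₂]
      simp [h₂]
  have h2 : ((x + 1 : ℤ) : WithTop ℤ) ≤ q.alpha i r ↔ (1 ≤ i → x < q.lo i r) := by
    by_cases h₁ : 1 ≤ i
    · rw [alpha_eq _ h₁ hi, WithTop.coe_le_coe]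
      simp only [h₁, true_imp_iff, Int.add_one_le_iff]
    · rw [alpha, dif_neg (by omega)]
      simp [h₁]
  rw [IIUnitAt, h1, h2]

/-- The arrays of positions of `(α; β)` are noncrossing. -/
abbrev IsNoncrossing (q : HalfPaths n l) : Prop := Noncrossing n l q.lo q.up

theorem exists_of_iUnitAt (q : HalfPaths n l) {i : ℕ} (hi : i ≤ l) {U : LatticeUnit}
    (h : q.IUnitAt i U) : ∃ j, 1 ≤ j ∧ j + 1 + U.row ≤ l ∧ U.row ≤ n ∧
      q.lo j U.row ≤ U.col ∧ U.col < q.up (j + 1 + U.row) U.row + 1 + U.row := by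
  cases U with
  | upper x r =>
    rw [iUnitAt_upper _ hi] at h
    refine ⟨i - r, by omega, ?_, h.1, ?_, ?_⟩ <;> simp only [LatticeUnit.row, LatticeUnit.col]
    · omega
    · omega
    · rw [show i - r + 1 + r = i + 1 by omega]
      omega
  | lower x r =>
    rw [iUnitAt_lower _ hi] at h
    exact ⟨i, h.2.1, h.2.2.1, h.1, h.2.2.2⟩

theorem exists_of_iiUnitAt (q : HalfPaths n l) (hq : q.IsNoncrossing) {i : ℕ} (hi : i ≤ l)
    {U : LatticeUnit} (h : q.IIUnitAt i U) : ∃ j, j ≤ l ∧ U.row ≤ n ∧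
      (j + 1 + U.row ≤ l → q.up (j + 1 + U.row) U.row + 1 + U.row ≤ U.col) ∧
      (1 ≤ j → U.col < q.lo j U.row) := by
  cases U with
  | upper x r =>
    rw [iiUnitAt_upper _ hi] at h
    refine ⟨i - r, by omega, h.1, ?_, ?_⟩ <;> simp only [LatticeUnit.row, LatticeUnit.col]
    · intro hl
      have := h.2.1 (by omega)
      have := hq.up_anti (r := r) h.1 (i := i + 1) (k := i - r + 1 + r) (by omega) (by omega) hl
      omega
    · intro hr
      have := h.2.2 (by omega)
      omega
  | lower x r =>
    rw [iiUnitAt_lower _ hi] at h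
    exact ⟨i, hi, h⟩

theorem not_adjacent_or_eq (q : HalfPaths n l) (hq : q.IsNoncrossing) {U U' : LatticeUnit}
    (hU : U ∈ q.iUnits) (hU' : U' ∈ q.iiUnits) : ¬ U.Adjacent U' := by
  intro h
  obtain ⟨i, hi, hI⟩ := hU
  obtain ⟨i', hi', hII⟩ := hU'
  obtain ⟨j, h1, h2, h3, h4, h5⟩ := q.exists_of_iUnitAt hi hI
  obtain ⟨k, g1, g2, g3, g4⟩ := q.exists_of_iiUnitAt hq hi' hII
  obtain ⟨c1, c2, c3⟩ := h.col_row
  exact hq.not_adjacent h3 g2 h1 h2 h4 h5 g1 g3 g4 c1 c2 c3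

theorem disjoint_units (q : HalfPaths n l) (hq : q.IsNoncrossing) {U : LatticeUnit}
    (hU : U ∈ q.iUnits) (hU' : U ∈ q.iiUnits) : False := by
  refine q.not_adjacent_or_eq hq hU hU' ?_
  rw [LatticeUnit.adjacent_iff]
  simp

/-! ### Regions of either kind -/

/-- All I-units and II-units. -/
def units (q : HalfPaths n l) : Set LatticeUnit := q.iUnits ∪ q.iiUnits

/-- A I- or II-region. -/
def IsRegion (q : HalfPaths n l) (V : Set LatticeUnit) : Prop :=
  IsComponent q.units V ∧ (∃ U ∈ V, U.height = 0) ∧ ∀ U ∈ V, ¬ q.IsBoundary U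

theorem mem_iiUnits_of_isBoundary (q : HalfPaths n l) {U : LatticeUnit} (h : q.IsBoundary U) :
    U ∈ q.iiUnits := by
  cases U with
  | upper x r =>
    obtain ⟨i, hi, h, -⟩ := h
    exact ⟨i, hi, h⟩
  | lower x r =>
    obtain ⟨i, hi, h, -⟩ := h
    exact ⟨i, hi, h⟩

theorem isIRegion_iff (q : HalfPaths n l) (hq : q.IsNoncrossing) (V : Set LatticeUnit) :
    q.IsIRegion V ↔ q.IsRegion V ∧ V ⊆ q.iUnits := by
  simp only [IsIRegion, IsRegion, isComponent_iff]
  constructor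
  · rintro ⟨⟨h1, h2, h3⟩, h4⟩
    refine ⟨⟨⟨h1, fun U hU => .inl (h2 hU), ?_⟩, h4, ?_⟩, h2⟩
    · rintro U hU U' (hU' | hU') hadj
      · exact h3 U hU U' hU' hadj
      · exact (q.not_adjacent_or_eq hq (h2 hU) hU' hadj).elim
    · intro U hU hb
      exact q.disjoint_units hq (h2 hU) (q.mem_iiUnits_of_isBoundary hb)
  · rintro ⟨⟨⟨h1, -, h3⟩, h4, -⟩, h2⟩
    exact ⟨⟨h1, h2, fun U hU U' hU' => h3 U hU U' (.inl hU')⟩, h4⟩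

theorem isIIRegion_iff (q : HalfPaths n l) (hq : q.IsNoncrossing) (V : Set LatticeUnit) :
    q.IsIIRegion V ↔ q.IsRegion V ∧ V ⊆ q.iiUnits := by
  simp only [IsIIRegion, IsRegion, isComponent_iff]
  constructor
  · rintro ⟨⟨h1, h2, h3⟩, h4, h5⟩
    refine ⟨⟨⟨h1, fun U hU => .inr (h2 hU), ?_⟩, h4, h5⟩, h2⟩
    rintro U hU U' (hU' | hU') hadj
    · exact (q.not_adjacent_or_eq hq hU' (h2 hU) hadj.symm).elim
    · exact h3 U hU U' hU' hadj
  · rintro ⟨⟨⟨h1, -, h3⟩, h4, h5⟩, h2⟩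
    exact ⟨⟨h1, h2, fun U hU U' hU' => h3 U hU U' (.inr hU')⟩, h4, h5⟩

theorem IsRegion.subset_or (q : HalfPaths n l) (hq : q.IsNoncrossing) {V : Set LatticeUnit}
    (hV : q.IsRegion V) : V ⊆ q.iUnits ∨ V ⊆ q.iiUnits := by
  obtain ⟨⟨hconn, hsub, -⟩, -⟩ := (isComponent_iff _ _).1 hV.1, hV.2
  by_cases hne : (V ∩ q.iUnits).Nonempty
  · left
    rw [← hconn.2 (V ∩ q.iUnits) Set.inter_subset_left hne ?_]
    · exact Set.inter_subset_right
    · rintro U ⟨hU, hUI⟩ U' hU' hadj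
      refine ⟨hU', (hsub hU').resolve_right fun h => ?_⟩
      exact q.not_adjacent_or_eq hq hUI h hadj
  · right
    intro U hU
    exact (hsub hU).resolve_left fun h => hne ⟨U, hU, h⟩

end HalfPaths

theorem LatticeUnit.lower_adjacent {x x' : ℤ} {r r' : ℕ} (hx : -1 ≤ x' - x ∧ x' - x ≤ 1)
    (hr : -1 ≤ (r' : ℤ) - r ∧ (r' : ℤ) - r ≤ 1)
    (hd : -1 ≤ x' - x - ((r' : ℤ) - r) ∧ x' - x - ((r' : ℤ) - r) ≤ 1) :
    (lower x r).Adjacent (lower x' r') := by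
  rw [adjacent_iff]
  simp only [corner]
  omega

theorem Noncrossing.congr {n l : ℕ} {A B A' B' : ℕ → ℕ → ℤ} (h : Noncrossing n l A B)
    (hA : ∀ i r, 1 ≤ i → i ≤ l → r ≤ n → A' i r = A i r)
    (hB : ∀ i r, 1 ≤ i → i ≤ l → r ≤ n → B' i r = B i r) : Noncrossing n l A' B' where
  lo_mono i r hi hl hr := by
    rw [hA _ _ hi hl hr, hA _ _ hi hl hr.le]
    exact h.lo_mono i r hi hl hr
  lo_lt i r hi hl hr := by
    rw [hA _ _ (by omega) hl hr.le, hA _ _ hi (by omega) hr]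
    exact h.lo_lt i r hi hl hr
  lo_last i hi hl := by
    rw [hA _ _ (by omega) hl le_rfl, hA _ _ hi (by omega) le_rfl]
    exact h.lo_last i hi hl
  up_mono i r hi hl hr := by
    rw [hB _ _ hi hl hr, hB _ _ hi hl hr.le]
    exact h.up_mono i r hi hl hr
  up_lt i r hi hl hr := by
    rw [hB _ _ (by omega) hl hr, hB _ _ hi (by omega) hr.le]
    exact h.up_lt i r hi hl hr
  up_last i hi hl := by
    rw [hB _ _ (by omega) hl le_rfl, hB _ _ hi (by omega) le_rfl]
    exact h.up_last i hi hl
  dual_last i hi hl := by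
    rw [hB _ _ (by omega) hl le_rfl, hA _ _ hi (by omega) le_rfl]
    exact h.dual_last i hi hl

namespace HalfPaths

variable {n l : ℕ}

/-! ### Odd regions -/

/-- The indices of the even overlaps and even holes which meet `V` at height `0`. -/
def evenGaps (q : HalfPaths n l) (V : Set LatticeUnit) : Set ℕ :=
  {i | 1 ≤ i ∧ i < l ∧ Even (q.lo i 0 - q.up (i + 1) 0) ∧
    ∃ U ∈ V, U.height = 0 ∧ (q.IUnitAt i U ∨ q.IIUnitAt i U)}

theorem gap_eq (q : HalfPaths n l) {i : ℕ} (h : 1 ≤ i ∧ i < l) :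
    q.gap i h = q.lo i 0 - q.up (i + 1) 0 := by
  simp [gap, lo, up, h.1, h.2.le, Nat.succ_le_iff.2 h.2]

theorem gap_of_iUnitAt (q : HalfPaths n l) {i : ℕ} (h : 1 ≤ i ∧ i < l) {U : LatticeUnit}
    (hU : U.height = 0) (hI : q.IUnitAt i U) : q.gap i h ≤ 0 := by
  rw [gap_eq]
  cases U with
  | upper x r =>
    obtain rfl : r = 0 := by simpa [LatticeUnit.height] using hU
    rw [iUnitAt_upper _ h.2.le] at hI
    simp only [Nat.sub_zero] at hI
    omega
  | lower x r =>
    obtain rfl : r = 0 := by simpa [LatticeUnit.height] using hU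
    rw [iUnitAt_lower _ h.2.le] at hI
    simp only [Nat.add_zero] at hI
    omega

theorem gap_of_iiUnitAt (q : HalfPaths n l) {i : ℕ} (h : 1 ≤ i ∧ i < l) {U : LatticeUnit}
    (hU : U.height = 0) (hI : q.IIUnitAt i U) : 0 < q.gap i h := by
  rw [gap_eq]
  cases U with
  | upper x r =>
    obtain rfl : r = 0 := by simpa [LatticeUnit.height] using hU
    rw [iiUnitAt_upper _ h.2.le] at hI
    simp only [Nat.sub_zero] at hI
    have := hI.2.1 h.2
    have := hI.2.2 (by omega)
    omega
  | lower x r =>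
    obtain rfl : r = 0 := by simpa [LatticeUnit.height] using hU
    rw [iiUnitAt_lower _ h.2.le] at hI
    simp only [Nat.add_zero] at hI
    have := hI.2.1 h.2
    have := hI.2.2 h.1
    omega

theorem overlapCount_eq (q : HalfPaths n l) (hq : q.IsNoncrossing) {V : Set LatticeUnit}
    (hV : V ⊆ q.iUnits) : q.overlapCount V = (q.evenGaps V).ncard := by
  rw [overlapCount]
  congr 1
  ext i
  constructor
  · rintro ⟨h, -, h2, U, hU, h3, h4⟩
    exact ⟨h.1, h.2, by rwa [gap_eq] at h2, U, hU, h3, .inl h4⟩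
  · rintro ⟨h1, h2, h3, U, hU, h4, h5⟩
    have hI : q.IUnitAt i U := h5.resolve_right fun h =>
      q.disjoint_units hq (hV hU) ⟨i, h2.le, h⟩
    exact ⟨⟨h1, h2⟩, q.gap_of_iUnitAt _ h4 hI, by rwa [gap_eq], U, hU, h4, hI⟩

theorem holeCount_eq (q : HalfPaths n l) (hq : q.IsNoncrossing) {V : Set LatticeUnit}
    (hV : V ⊆ q.iiUnits) : q.holeCount V = (q.evenGaps V).ncard := by
  rw [holeCount]
  congr 1
  ext i
  constructor
  · rintro ⟨h, -, h2, U, hU, h3, h4⟩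
    exact ⟨h.1, h.2, by rwa [gap_eq] at h2, U, hU, h3, .inr h4⟩
  · rintro ⟨h1, h2, h3, U, hU, h4, h5⟩
    have hI : q.IIUnitAt i U := h5.resolve_left fun h =>
      q.disjoint_units hq ⟨i, h2.le, h⟩ (hV hU)
    exact ⟨⟨h1, h2⟩, q.gap_of_iiUnitAt _ h4 hI, by rwa [gap_eq], U, hU, h4, hI⟩

/-- The set of odd I- and II-regions. -/
def oddRegions (q : HalfPaths n l) : Set (Set LatticeUnit) :=
  {V | q.IsRegion V ∧ Odd (q.evenGaps V).ncard}

theorem hasOddRegion_iff (q : HalfPaths n l) (hq : q.IsNoncrossing) :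
    q.HasOddRegion ↔ q.oddRegions.Nonempty := by
  constructor
  · rintro (⟨V, hV, hodd⟩ | ⟨V, hV, hodd⟩)
    · rw [isIRegion_iff _ hq] at hV
      rw [overlapCount_eq _ hq hV.2] at hodd
      exact ⟨V, hV.1, hodd⟩
    · rw [isIIRegion_iff _ hq] at hV
      rw [holeCount_eq _ hq hV.2] at hodd
      exact ⟨V, hV.1, hodd⟩
  · rintro ⟨V, hV, hodd⟩
    rcases hV.subset_or q hq with h | h
    · exact .inl ⟨V, (isIRegion_iff _ hq _).2 ⟨hV, h⟩, by rwa [overlapCount_eq _ hq h]⟩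
    · exact .inr ⟨V, (isIIRegion_iff _ hq _).2 ⟨hV, h⟩, by rwa [holeCount_eq _ hq h]⟩

/-! ### Exchanging the paths with their duals inside a region -/

/-- `β*_{j+1}(-r)` as an integer. -/
def dual (q : HalfPaths n l) (j r : ℕ) : ℤ := q.up (j + 1 + r) r + 1 + r

/-- The position `x` is between `α_j(-r)` and `β*_{j+1}(-r)`. -/
def InStrip (q : HalfPaths n l) (j r : ℕ) (x : ℤ) : Prop :=
  q.lo j r ≤ x ∧ x < q.dual j r ∨ q.dual j r ≤ x ∧ x < q.lo j r

/-- Some unit of `V` at height `-r` is between `α_j` and `β*_{j+1}`. -/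
def Swapped (q : HalfPaths n l) (V : Set LatticeUnit) (j r : ℕ) : Prop :=
  1 ≤ j ∧ j + 1 + r ≤ l ∧ r ≤ n ∧ ∃ x, .lower x r ∈ V ∧ q.InStrip j r x

open Classical in
/-- The positions of the lower paths after the exchange in `V`. -/
def newLo (q : HalfPaths n l) (V : Set LatticeUnit) (j r : ℕ) : ℤ :=
  if q.Swapped V j r then q.dual j r else q.lo j r

open Classical in
/-- The positions of the duals of the upper paths after the exchange in `V`. -/
def newDual (q : HalfPaths n l) (V : Set LatticeUnit) (j r : ℕ) : ℤ :=
  if q.Swapped V j r then q.lo j r else q.dual j r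

/-- The positions of the upper paths after the exchange in `V`. -/
def newUp (q : HalfPaths n l) (V : Set LatticeUnit) (i r : ℕ) : ℤ :=
  if r + 1 ≤ i then q.newDual V (i - 1 - r) r - 1 - r else q.up i r

theorem newUp_add (q : HalfPaths n l) (V : Set LatticeUnit) (j r : ℕ) :
    q.newUp V (j + 1 + r) r = q.newDual V j r - 1 - r := by
  rw [newUp, if_pos (by omega), show j + 1 + r - 1 - r = j by omega]

theorem newUp_of_le (q : HalfPaths n l) (V : Set LatticeUnit) {i r : ℕ} (h : i ≤ r + 1) :
    q.newUp V i r = q.up i r := by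
  rcases h.lt_or_eq with h | rfl
  · rw [newUp, if_neg (by omega)]
  · rw [show r + 1 = 0 + 1 + r by ring, newUp_add, newDual, if_neg (fun h => by have := h.1; omega),
      dual]
    ring

theorem dual_mono (q : HalfPaths n l) (hq : q.IsNoncrossing) {j r : ℕ} (hl : j + 2 + r ≤ l)
    (hr : r < n) : q.dual j (r + 1) ≤ q.dual j r := by
  have := hq.up_lt (j + 1 + r) r (by omega) (by omega) hr
  rw [dual, dual, show j + 1 + (r + 1) = j + 1 + r + 1 by ring]
  push_cast
  omega

theorem dual_lt (q : HalfPaths n l) (hq : q.IsNoncrossing) {j r : ℕ} (hl : j + 2 + r ≤ l)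
    (hr : r < n) : q.dual (j + 1) r < q.dual j (r + 1) := by
  have := hq.up_mono (j + 1 + 1 + r) r (by omega) (by omega) hr
  rw [dual, dual, show j + 1 + (r + 1) = j + 1 + 1 + r by ring]
  push_cast
  omega

theorem mem_units_of_inStrip (q : HalfPaths n l) {j r : ℕ} {x : ℤ} (hj : 1 ≤ j)
    (hl : j + 1 + r ≤ l) (hr : r ≤ n) (hx : q.InStrip j r x) : .lower x r ∈ q.units := by
  rcases hx with hx | hx
  · exact .inl ⟨j, by omega, (iUnitAt_lower _ (by omega)).2 ⟨hr, hj, hl, hx⟩⟩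
  · exact .inr ⟨j, by omega, (iiUnitAt_lower _ (by omega)).2 ⟨hr, fun _ => hx.1, fun _ => hx.2⟩⟩

section Region

variable {q : HalfPaths n l} {V : Set LatticeUnit}

theorem IsRegion.closed (hV : q.IsRegion V) : ClosedIn V q.units :=
  ((isComponent_iff _ _).1 hV.1).2.2

theorem IsRegion.lower_mem (hV : q.IsRegion V) {j r : ℕ} {x : ℤ} (hT : q.Swapped V j r)
    (hx : q.InStrip j r x) : .lower x r ∈ V := by
  obtain ⟨hj, hl, hr, x₀, h₀, hx₀⟩ := hT
  have hadj : ∀ y, q.InStrip j r y → q.InStrip j r (y + 1) →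
      (LatticeUnit.lower y r ∈ V ↔ .lower (y + 1) r ∈ V) := by
    intro y hy hy'
    have h : (LatticeUnit.lower y r).Adjacent (.lower (y + 1) r) :=
      LatticeUnit.lower_adjacent (by omega) (by omega) (by omega)
    exact ⟨fun hm => hV.closed _ hm _ (q.mem_units_of_inStrip hj hl hr hy') h,
      fun hm => hV.closed _ hm _ (q.mem_units_of_inStrip hj hl hr hy) h.symm⟩
  rcases le_total x₀ x with hle | hle
  · induction x, hle using Int.leInduction with
    | base => exact h₀
    | succ y hy ih =>
      have hy' : q.InStrip j r y := by
        unfold InStrip at *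
        omega
      exact (hadj y hy' hx).1 (ih hy')
  · induction x, hle using Int.leInductionDown with
    | base => exact h₀
    | pred y hy ih =>
      have hy' : q.InStrip j r y := by
        unfold InStrip at *
        omega
      exact (hadj (y - 1) hx (by simpa using hy')).2 (by simpa using ih hy')

theorem IsRegion.swapped_of_adjacent (hV : q.IsRegion V) {j r j' r' : ℕ} {x x' : ℤ}
    (hT : q.Swapped V j r) (hx : q.InStrip j r x) (hj : 1 ≤ j') (hl : j' + 1 + r' ≤ l)
    (hr : r' ≤ n) (hx' : q.InStrip j' r' x')
    (h : (LatticeUnit.lower x r).Adjacent (.lower x' r')) : q.Swapped V j' r' :=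
  ⟨hj, hl, hr, x', hV.closed _ (hV.lower_mem hT hx) _ (q.mem_units_of_inStrip hj hl hr hx') h, hx'⟩

theorem IsRegion.not_adjacent_boundary (hV : q.IsRegion V) {j r k r' : ℕ} {x x' : ℤ}
    (hT : q.Swapped V j r) (hx : q.InStrip j r x) (hk : k ≤ l)
    (hx' : q.IIUnitAt k (.lower x' r')) (hb : k = 0 ∨ l ≤ k + r' ∨ r' = n)
    (h : (LatticeUnit.lower x r).Adjacent (.lower x' r')) : False :=
  hV.2.2 _ (hV.closed _ (hV.lower_mem hT hx) _ (.inr ⟨k, hk, hx'⟩) h) ⟨k, hk, hx', hb⟩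

theorem IsRegion.swapped_lt (hV : q.IsRegion V) (hq : q.IsNoncrossing) {j r : ℕ}
    (hT : q.Swapped V j r) : r < n := by
  have h := hT
  obtain ⟨hj, hl, hr, x, hxV, hx⟩ := h
  refine hr.lt_of_ne ?_
  rintro rfl
  have h1 := hq.dual_last j hj hl
  rcases hx with hx | hx
  · rw [dual] at hx
    omega
  · refine hV.2.2 _ hxV ⟨j, by omega, ?_, .inr (.inr rfl)⟩
    rw [iiUnitAt_lower _ (by omega)]
    exact ⟨le_rfl, fun _ => hx.1, fun _ => hx.2⟩

theorem newLo_mono (hV : q.IsRegion V) (hq : q.IsNoncrossing) {j r : ℕ} (hj : 1 ≤ j)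
    (hl : j ≤ l) (hr : r < n) : q.newLo V j (r + 1) ≤ q.newLo V j r := by
  have ha := hq.lo_mono j r hj hl hr
  unfold newLo
  split_ifs with h1 h2 h2
  · exact q.dual_mono hq (by have := h1.2.1; omega) hr
  · by_contra! hlt
    have hd := q.dual_mono hq (j := j) (by have := h1.2.1; omega) hr
    refine h2 (hV.swapped_of_adjacent h1 (x := q.lo j r) (x' := q.lo j r) (.inl ⟨ha, hlt⟩) hj
      (by have := h1.2.1; omega) hr.le (.inl ⟨le_rfl, by omega⟩) ?_)
    exact LatticeUnit.lower_adjacent (by omega) (by push_cast; omega) (by push_cast; omega)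
  · by_contra! hlt
    have hadj : (LatticeUnit.lower (q.dual j r) r).Adjacent (.lower (q.dual j r) (r + 1)) :=
      LatticeUnit.lower_adjacent (by omega) (by push_cast; omega) (by push_cast; omega)
    have hx : q.InStrip j r (q.dual j r) := .inr ⟨le_rfl, by omega⟩
    by_cases hval : j + 2 + r ≤ l
    · have hd := q.dual_mono hq hval hr
      exact h1 (hV.swapped_of_adjacent h2 hx hj (by omega) hr (.inr ⟨hd, hlt⟩) hadj)
    · refine hV.not_adjacent_boundary h2 hx hl ?_ (.inr (.inl (by omega))) hadj
      rw [iiUnitAt_lower _ hl]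
      exact ⟨hr, fun h => by omega, fun _ => hlt⟩
  · exact ha

theorem newLo_lt (hV : q.IsRegion V) (hq : q.IsNoncrossing) {j r : ℕ} (hj : 1 ≤ j)
    (hl : j + 1 ≤ l) (hr : r < n) : q.newLo V (j + 1) r < q.newLo V j (r + 1) := by
  have ha := hq.lo_lt j r hj hl hr
  unfold newLo
  split_ifs with h1 h2 h2
  · exact q.dual_lt hq (by have := h1.2.1; omega) hr
  · by_contra! hlt
    have hd := q.dual_lt hq (j := j) (by have := h1.2.1; omega) hr
    refine h2 (hV.swapped_of_adjacent h1 (x := q.lo j (r + 1) - 1) (x' := q.lo j (r + 1))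
      (.inl ⟨by omega, by omega⟩) hj (by have := h1.2.1; omega) hr (.inl ⟨le_rfl, by omega⟩) ?_)
    exact LatticeUnit.lower_adjacent (by omega) (by push_cast; omega) (by push_cast; omega)
  · by_contra! hlt
    have hd := q.dual_lt hq (j := j) (by have := h2.2.1; omega) hr
    refine h1 (hV.swapped_of_adjacent h2 (x := q.lo (j + 1) r) (x' := q.lo (j + 1) r - 1)
      (.inr ⟨by omega, by omega⟩) (by omega) (by have := h2.2.1; omega) hr.le
      (.inr ⟨by omega, by omega⟩) ?_)
    exact LatticeUnit.lower_adjacent (by omega) (by push_cast; omega) (by push_cast; omega)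
  · exact ha

theorem newDual_mono (hV : q.IsRegion V) (hq : q.IsNoncrossing) {j r : ℕ} (hl : j + 2 + r ≤ l)
    (hr : r < n) : q.newDual V j (r + 1) ≤ q.newDual V j r := by
  have hd := q.dual_mono hq hl hr
  unfold newDual
  split_ifs with h1 h2 h2
  · exact hq.lo_mono j r h1.1 (by omega) hr
  · by_contra! hlt
    have ha := hq.lo_mono j r h1.1 (by omega) hr
    refine h2 (hV.swapped_of_adjacent h1 (x := q.dual j r) (x' := q.dual j r) (.inr ⟨hd, hlt⟩) h1.1
      (by omega) hr.le (.inr ⟨le_rfl, by omega⟩) ?_)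
    exact LatticeUnit.lower_adjacent (by omega) (by push_cast; omega) (by push_cast; omega)
  · by_contra! hlt
    have ha := hq.lo_mono j r h2.1 (by omega) hr
    refine h1 (hV.swapped_of_adjacent h2 (x := q.lo j r) (x' := q.lo j r)
      (.inl ⟨le_rfl, by omega⟩) h2.1 (by omega) hr (.inl ⟨ha, hlt⟩) ?_)
    exact LatticeUnit.lower_adjacent (by omega) (by push_cast; omega) (by push_cast; omega)
  · exact hd

theorem newDual_lt (hV : q.IsRegion V) (hq : q.IsNoncrossing) {j r : ℕ} (hl : j + 2 + r ≤ l)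
    (hr : r < n) : q.newDual V (j + 1) r < q.newDual V j (r + 1) := by
  have hd := q.dual_lt hq hl hr
  unfold newDual
  split_ifs with h1 h2 h2
  · exact hq.lo_lt j r h2.1 (by omega) hr
  · by_contra! hlt
    have hadj : (LatticeUnit.lower (q.dual j (r + 1) - 1) r).Adjacent
        (.lower (q.dual j (r + 1)) (r + 1)) :=
      LatticeUnit.lower_adjacent (by omega) (by push_cast; omega) (by push_cast; omega)
    have hx : q.InStrip (j + 1) r (q.dual j (r + 1) - 1) := .inr ⟨by omega, by omega⟩
    rcases Nat.eq_zero_or_pos j with rfl | hj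
    · refine hV.not_adjacent_boundary h1 hx (Nat.zero_le l) ?_ (.inl rfl) hadj
      rw [iiUnitAt_lower _ (Nat.zero_le l)]
      exact ⟨hr, fun _ => le_rfl, fun h => by omega⟩
    · have ha := hq.lo_lt j r hj (by omega) hr
      exact h2 (hV.swapped_of_adjacent h1 hx hj (by omega) hr (.inr ⟨le_rfl, by omega⟩) hadj)
  · by_contra! hlt
    have ha := hq.lo_lt j r h2.1 (by omega) hr
    refine h1 (hV.swapped_of_adjacent h2 (x := q.lo j (r + 1)) (x' := q.lo j (r + 1) - 1)
      (.inl ⟨le_rfl, by omega⟩) (by omega) (by omega) hr.le (.inl ⟨by omega, by omega⟩) ?_)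
    exact LatticeUnit.lower_adjacent (by omega) (by push_cast; omega) (by push_cast; omega)
  · exact hd

theorem newLo_last (hV : q.IsRegion V) (hq : q.IsNoncrossing) (i : ℕ) :
    q.newLo V i n = q.lo i n :=
  if_neg fun h => (hV.swapped_lt hq h).false

theorem newUp_last (hV : q.IsRegion V) (hq : q.IsNoncrossing) (i : ℕ) :
    q.newUp V i n = q.up i n := by
  rcases le_or_gt i (n + 1) with h | h
  · exact q.newUp_of_le V h
  · obtain ⟨j, rfl⟩ : ∃ j, i = j + 1 + n := ⟨i - 1 - n, by omega⟩
    rw [newUp_add, newDual, if_neg fun h => (hV.swapped_lt hq h).false, dual]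
    ring

theorem IsRegion.noncrossing (hV : q.IsRegion V) (hq : q.IsNoncrossing) :
    Noncrossing n l (q.newLo V) (q.newUp V) where
  lo_mono i r hi hl hr := newLo_mono hV hq hi hl hr
  lo_lt i r hi hl hr := newLo_lt hV hq hi hl hr
  lo_last i hi hl := by
    rw [newLo_last hV hq, newLo_last hV hq]
    exact hq.lo_last i hi hl
  up_mono i r hi hl hr := by
    rcases le_or_gt i (r + 1) with h | h
    · rw [newUp_of_le _ _ h, newUp_of_le _ _ (by omega)]
      exact hq.up_mono i r hi hl hr
    · obtain ⟨j, rfl⟩ : ∃ j, i = j + 1 + 1 + r := ⟨i - 2 - r, by omega⟩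
      have := newDual_lt hV hq (j := j) (r := r) (by omega) hr
      rw [newUp_add, show j + 1 + 1 + r = j + 1 + (r + 1) by ring, newUp_add]
      push_cast
      omega
  up_lt i r hi hl hr := by
    rcases le_or_gt i r with h | h
    · rw [newUp_of_le _ _ (by omega), newUp_of_le _ _ (by omega)]
      exact hq.up_lt i r hi hl hr
    · obtain ⟨j, rfl⟩ : ∃ j, i = j + 1 + r := ⟨i - 1 - r, by omega⟩
      have := newDual_mono hV hq (j := j) (r := r) (by omega) hr
      rw [newUp_add, show j + 1 + r + 1 = j + 1 + (r + 1) by ring, newUp_add]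
      push_cast
      omega
  up_last i hi hl := by
    rw [newUp_last hV hq, newUp_last hV hq]
    exact hq.up_last i hi hl
  dual_last i hi hl := by
    rw [newUp_last hV hq, newLo_last hV hq]
    exact hq.dual_last i hi hl

/-- `q'` arises from `q` by the exchange in `V`. -/
structure IsSwap (q q' : HalfPaths n l) (V : Set LatticeUnit) : Prop where
  lo_eq : ∀ i r, 1 ≤ i → i ≤ l → r ≤ n → q'.lo i r = q.newLo V i r
  up_eq : ∀ i r, 1 ≤ i → i ≤ l → r ≤ n → q'.up i r = q.newUp V i r

variable {q' : HalfPaths n l}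

theorem IsSwap.isNoncrossing (h : IsSwap q q' V) (hV : q.IsRegion V) (hq : q.IsNoncrossing) :
    q'.IsNoncrossing :=
  (hV.noncrossing hq).congr h.lo_eq h.up_eq

theorem IsSwap.strip (h : IsSwap q q' V) {j r : ℕ} (hj : 1 ≤ j) (hl : j + 1 + r ≤ l)
    (hr : r ≤ n) : q'.lo j r = q.lo j r ∧ q'.dual j r = q.dual j r ∨
      q'.lo j r = q.dual j r ∧ q'.dual j r = q.lo j r := by
  rw [h.lo_eq _ _ hj (by omega) hr, dual, h.up_eq _ _ (by omega) hl hr, newUp_add, newLo, newDual]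
  split_ifs
  · right
    constructor <;> ring
  · left
    constructor <;> ring

theorem IsSwap.lo_of_lt (h : IsSwap q q' V) {j r : ℕ} (hj : 1 ≤ j) (hjl : j ≤ l)
    (hl : l < j + 1 + r) (hr : r ≤ n) : q'.lo j r = q.lo j r := by
  rw [h.lo_eq _ _ hj hjl hr, newLo, if_neg fun h => by have := h.2.1; omega]

theorem IsSwap.up_of_le (h : IsSwap q q' V) {i r : ℕ} (hi : 1 ≤ i) (hl : i ≤ l)
    (hir : i ≤ r + 1) (hr : r ≤ n) : q'.up i r = q.up i r := by
  rw [h.up_eq _ _ hi hl hr, newUp_of_le _ _ hir]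

theorem IsSwap.inStrip_iff (h : IsSwap q q' V) {j r : ℕ} {x : ℤ} (hj : 1 ≤ j)
    (hl : j + 1 + r ≤ l) (hr : r ≤ n) : q'.InStrip j r x ↔ q.InStrip j r x := by
  unfold InStrip
  rcases h.strip hj hl hr with ⟨h1, h2⟩ | ⟨h1, h2⟩ <;> rw [h1, h2]
  exact or_comm

theorem unitAt_upper (q : HalfPaths n l) {i r : ℕ} {x : ℤ} (h : r < i) (hi : i < l) :
    (q.IUnitAt i (.upper x r) ∨ q.IIUnitAt i (.upper x r)) ↔
      r ≤ n ∧ q.InStrip (i - r) r (x + r + 1) := by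
  rw [iUnitAt_upper _ hi.le, iiUnitAt_upper _ hi.le, InStrip, dual,
    show i - r + 1 + r = i + 1 by omega]
  simp only [h, hi, true_and, true_imp_iff]
  omega

theorem unitAt_lower (q : HalfPaths n l) {i r : ℕ} {x : ℤ} (h : 1 ≤ i) (hi : i + 1 + r ≤ l) :
    (q.IUnitAt i (.lower x r) ∨ q.IIUnitAt i (.lower x r)) ↔ r ≤ n ∧ q.InStrip i r x := by
  rw [iUnitAt_lower _ (by omega), iiUnitAt_lower _ (by omega), InStrip, dual]
  simp only [h, hi, true_and, true_imp_iff]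
  omega

theorem IsSwap.iiUnitAt_upper (h : IsSwap q q' V) {i r : ℕ} {x : ℤ} (hi : i ≤ l)
    (hb : i ≤ r ∨ i = l) : q'.IIUnitAt i (.upper x r) ↔ q.IIUnitAt i (.upper x r) := by
  rw [HalfPaths.iiUnitAt_upper _ hi, HalfPaths.iiUnitAt_upper _ hi]
  refine and_congr_right fun hr => and_congr (forall_congr' fun hil => ?_)
    (forall_congr' fun hri => ?_)
  · rw [h.up_of_le (by omega) (by omega) (by omega) hr]
  · rw [h.lo_of_lt (by omega) (by omega) (by omega) hr]

theorem IsSwap.iiUnitAt_lower (h : IsSwap q q' V) {i r : ℕ} {x : ℤ} (hi : i ≤ l)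
    (hb : i = 0 ∨ l < i + 1 + r) : q'.IIUnitAt i (.lower x r) ↔ q.IIUnitAt i (.lower x r) := by
  rw [HalfPaths.iiUnitAt_lower _ hi, HalfPaths.iiUnitAt_lower _ hi]
  refine and_congr_right fun hr => and_congr (forall_congr' fun hil => ?_)
    (forall_congr' fun hri => ?_)
  · rw [h.up_of_le (by omega) (by omega) (by omega) hr]
  · rw [h.lo_of_lt (by omega) (by omega) (by omega) hr]

theorem IsSwap.unitAt_iff (h : IsSwap q q' V) {i : ℕ} (hi : i ≤ l) (U : LatticeUnit) :
    (q'.IUnitAt i U ∨ q'.IIUnitAt i U) ↔ (q.IUnitAt i U ∨ q.IIUnitAt i U) := by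
  cases U with
  | upper x r =>
    by_cases hb : i ≤ r ∨ i = l
    · rw [h.iiUnitAt_upper hi hb, iUnitAt_upper _ hi, iUnitAt_upper _ hi]
      refine or_congr ?_ Iff.rfl
      constructor <;> intro <;> omega
    · rw [unitAt_upper _ (by omega) (by omega), unitAt_upper _ (by omega) (by omega)]
      exact and_congr_right fun hr => h.inStrip_iff (by omega) (by omega) hr
  | lower x r =>
    by_cases hb : i = 0 ∨ l < i + 1 + r
    · rw [h.iiUnitAt_lower hi hb, iUnitAt_lower _ hi, iUnitAt_lower _ hi]
      refine or_congr ?_ Iff.rfl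
      constructor <;> intro <;> omega
    · rw [unitAt_lower _ (by omega) (by omega), unitAt_lower _ (by omega) (by omega)]
      exact and_congr_right fun hr => h.inStrip_iff (by omega) (by omega) hr

theorem IsSwap.lo_last (h : IsSwap q q' V) (hV : q.IsRegion V) (hq : q.IsNoncrossing) {i : ℕ}
    (hi : 1 ≤ i) (hl : i ≤ l) : q'.lo i n = q.lo i n := by
  rw [h.lo_eq _ _ hi hl le_rfl, newLo_last hV hq]

theorem IsSwap.up_last (h : IsSwap q q' V) (hV : q.IsRegion V) (hq : q.IsNoncrossing) {i : ℕ}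
    (hi : 1 ≤ i) (hl : i ≤ l) : q'.up i n = q.up i n := by
  rw [h.up_eq _ _ hi hl le_rfl, newUp_last hV hq]

theorem IsSwap.isBoundary_iff (h : IsSwap q q' V) (hV : q.IsRegion V) (hq : q.IsNoncrossing)
    (U : LatticeUnit) : q'.IsBoundary U ↔ q.IsBoundary U := by
  cases U with
  | upper x r =>
    refine exists_congr fun i => and_congr_right fun hi => and_congr_left fun hb => ?_
    rcases or_assoc.2 hb with hb | rfl
    · exact h.iiUnitAt_upper hi hb
    · rw [HalfPaths.iiUnitAt_upper _ hi, HalfPaths.iiUnitAt_upper _ hi]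
      refine and_congr_right fun hr => and_congr (forall_congr' fun hil => ?_)
        (forall_congr' fun hri => ?_)
      · rw [h.up_last hV hq (by omega) (by omega)]
      · rw [h.lo_last hV hq (by omega) (by omega)]
  | lower x r =>
    refine exists_congr fun i => and_congr_right fun hi => and_congr_left fun hb => ?_
    rcases or_assoc.2 hb with hb | rfl
    · exact h.iiUnitAt_lower hi (by omega)
    · rw [HalfPaths.iiUnitAt_lower _ hi, HalfPaths.iiUnitAt_lower _ hi]
      refine and_congr_right fun hr => and_congr (forall_congr' fun hil => ?_)
        (forall_congr' fun hri => ?_)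
      · rw [h.up_last hV hq (by omega) (by omega)]
      · rw [h.lo_last hV hq (by omega) (by omega)]

theorem IsSwap.units_eq (h : IsSwap q q' V) : q'.units = q.units := by
  ext U
  have key : ∀ p : HalfPaths n l, U ∈ p.units ↔ ∃ i ≤ l, p.IUnitAt i U ∨ p.IIUnitAt i U := by
    intro p
    constructor
    · rintro (⟨i, hi, hU⟩ | ⟨i, hi, hU⟩)
      · exact ⟨i, hi, .inl hU⟩
      · exact ⟨i, hi, .inr hU⟩
    · rintro ⟨i, hi, hU | hU⟩
      · exact .inl ⟨i, hi, hU⟩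
      · exact .inr ⟨i, hi, hU⟩
  rw [key, key]
  exact exists_congr fun i => and_congr_right fun hi => h.unitAt_iff hi U

theorem IsSwap.isRegion_iff (h : IsSwap q q' V) (hV : q.IsRegion V) (hq : q.IsNoncrossing)
    (W : Set LatticeUnit) : q'.IsRegion W ↔ q.IsRegion W := by
  simp only [IsRegion, h.units_eq, h.isBoundary_iff hV hq]

theorem IsSwap.evenGaps_eq (h : IsSwap q q' V) (W : Set LatticeUnit) :
    q'.evenGaps W = q.evenGaps W := by
  ext i
  refine and_congr_right fun hi => and_congr_right fun hl => and_congr ?_ ?_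
  · have := h.strip (j := i) (r := 0) hi (by omega) (by omega)
    simp only [dual, Nat.cast_zero, add_zero] at this
    rw [Int.even_iff, Int.even_iff]
    omega
  · exact exists_congr fun U => and_congr_right fun _ => and_congr_right fun _ =>
      h.unitAt_iff hl.le U

theorem IsSwap.oddRegions_eq (h : IsSwap q q' V) (hV : q.IsRegion V) (hq : q.IsNoncrossing) :
    q'.oddRegions = q.oddRegions := by
  ext W
  simp only [oddRegions, Set.mem_ofPred_eq, h.isRegion_iff hV hq, h.evenGaps_eq]

theorem IsSwap.swapped_iff (h : IsSwap q q' V) (j r : ℕ) :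
    q'.Swapped V j r ↔ q.Swapped V j r :=
  and_congr_right fun hj => and_congr_right fun hl => and_congr_right fun hr =>
    exists_congr fun _ => and_congr_right fun _ => h.inStrip_iff hj hl hr

theorem IsSwap.lo_eq_of_isSwap (h : IsSwap q q' V) {q'' : HalfPaths n l} (h' : IsSwap q' q'' V)
    {i r : ℕ} (hi : 1 ≤ i) (hl : i ≤ l) (hr : r ≤ n) : q''.lo i r = q.lo i r := by
  rw [h'.lo_eq _ _ hi hl hr, newLo, h.swapped_iff]
  split_ifs with hT
  · rw [dual, h.up_eq _ _ (by omega) hT.2.1 hr, newUp_add, newDual, if_pos hT]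
    ring
  · rw [h.lo_eq _ _ hi hl hr, newLo, if_neg hT]

theorem IsSwap.up_eq_of_isSwap (h : IsSwap q q' V) {q'' : HalfPaths n l} (h' : IsSwap q' q'' V)
    {i r : ℕ} (hi : 1 ≤ i) (hl : i ≤ l) (hr : r ≤ n) : q''.up i r = q.up i r := by
  rcases le_or_gt i r with hir | hir
  · rw [h'.up_of_le hi hl (by omega) hr, h.up_of_le hi hl (by omega) hr]
  · obtain ⟨j, rfl⟩ : ∃ j, i = j + 1 + r := ⟨i - 1 - r, by omega⟩
    rw [h'.up_eq _ _ hi hl hr, newUp_add, newDual, h.swapped_iff]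
    split_ifs with hT
    · rw [h.lo_eq _ _ hT.1 (by omega) hr, newLo, if_pos hT, dual]
      ring
    · rw [dual, h.up_eq _ _ hi hl hr, newUp_add, newDual, if_neg hT, dual]
      ring

theorem IsRegion.mem_evenGaps_iff (hV : q.IsRegion V) (i : ℕ) :
    i ∈ q.evenGaps V ↔ q.Swapped V i 0 ∧ Even (q.lo i 0 - q.up (i + 1) 0) := by
  constructor
  · rintro ⟨hi, hl, heven, U, hU, h0, hat⟩
    refine ⟨⟨hi, hl, Nat.zero_le n, ?_⟩, heven⟩
    cases U with
    | upper x r =>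
      obtain rfl : r = 0 := by simpa [LatticeUnit.height] using h0
      rw [unitAt_upper _ (by omega) hl] at hat
      have hx : q.InStrip i 0 (x + 1) := by simpa using hat.2
      refine ⟨x + 1, hV.closed _ hU _ (q.mem_units_of_inStrip hi hl (Nat.zero_le n) hx) ?_, hx⟩
      rw [LatticeUnit.adjacent_iff]
      simp only [LatticeUnit.corner]
      omega
    | lower x r =>
      obtain rfl : r = 0 := by simpa [LatticeUnit.height] using h0
      rw [unitAt_lower _ hi hl] at hat
      exact ⟨x, hU, hat.2⟩
  · rintro ⟨⟨hi, hl, -, x, hxV, hx⟩, heven⟩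
    exact ⟨hi, hl, heven, _, hxV, rfl, (unitAt_lower _ hi hl).2 ⟨Nat.zero_le n, hx⟩⟩

end Region

end HalfPaths

/-! ### Sums over pairs of shifted indices -/

/-- Comparison of two pairs of products when only the factors `k` of the first and `k + s` of the
second product are changed. -/
@[to_additive]
theorem prod_mul_prod_shift {M : Type*} [CommMonoid M] (l s : ℕ) {u u' v v' c : ℕ → M}
    (h : ∀ k, k + s < l → u' k * v' (k + s) = u k * v (k + s) * c k)
    (hu : ∀ k, k < l → l ≤ k + s → u' k = u k) (hv : ∀ k, k < l → k < s → v' k = v k) :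
    (∏ k ∈ range l, u' k) * ∏ k ∈ range l, v' k =
      ((∏ k ∈ range l, u k) * ∏ k ∈ range l, v k) * ∏ k ∈ range (l - s), c k := by
  rcases le_or_gt s l with hs | hs
  · obtain ⟨m, rfl⟩ := Nat.exists_eq_add_of_le' hs
    have hsplit : ∀ f g : ℕ → M, (∏ k ∈ range (m + s), f k) * ∏ k ∈ range (m + s), g k =
        ((∏ k ∈ range s, f (m + k)) * ∏ k ∈ range s, g k) *
          ∏ k ∈ range m, (f k * g (k + s)) := by
      intro f g
      rw [prod_range_add, add_comm m s, prod_range_add, prod_mul_distrib]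
      simp only [add_comm s]
      ac_rfl
    rw [hsplit, hsplit, Nat.add_sub_cancel, mul_assoc _ _ (∏ k ∈ range m, c k),
      ← prod_mul_distrib (s := range m) (f := fun k => u k * v (k + s)) (g := c)]
    congr 1
    · congr 1
      · refine prod_congr rfl fun k hk => ?_
        have := mem_range.1 hk
        exact hu _ (by omega) (by omega)
      · refine prod_congr rfl fun k hk => ?_
        have := mem_range.1 hk
        exact hv _ (by omega) this
    · refine prod_congr rfl fun k hk => ?_
      have := mem_range.1 hk
      exact h k (by omega)
  · rw [Nat.sub_eq_zero_of_le hs.le, prod_range_zero, mul_one]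
    congr 1
    · refine prod_congr rfl fun k hk => ?_
      have := mem_range.1 hk
      exact hu _ this (by omega)
    · refine prod_congr rfl fun k hk => ?_
      have := mem_range.1 hk
      exact hv _ this (by omega)

/-! ### Intervals of even length with disjoint intervals of equal parity -/

/-- The intervals `[a i, b (σ i)]` have even length, and those with left ends of the same parity
are disjoint. -/
structure Interlacing {l : ℕ} (a b : Fin l → ℤ) (σ : Equiv.Perm (Fin l)) : Prop where
  anti_left : StrictAnti a
  anti_right : StrictAnti b
  le : ∀ i, a i ≤ b (σ i)
  even : ∀ i, Even (b (σ i) - a i)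
  disjoint : ∀ i j, i ≠ j → Even (a i - a j) → b (σ i) < a j ∨ b (σ j) < a i

namespace Interlacing

variable {l : ℕ} {a b : Fin l → ℤ} {σ τ : Equiv.Perm (Fin l)}

theorem right_le_of_le (h : Interlacing a b σ) {i m : Fin l} (hle : a i ≤ b m)
    (he : Even (b m - a i)) : b (σ i) ≤ b m := by
  by_contra! hlt
  obtain ⟨k, rfl⟩ := σ.surjective m
  have hki : k ≠ i := by
    rintro rfl
    exact hlt.false
  have h1 := h.even k
  have h2 := h.le k
  rcases h.disjoint k i hki (by rw [Int.even_iff] at *; omega) with h3 | h3 <;> omega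

theorem unique (h : Interlacing a b σ) (h' : Interlacing a b τ) : σ = τ := by
  ext i
  congr 1
  exact h.anti_right.injective ((h.right_le_of_le (h'.le i) (h'.even i)).antisymm
    (h'.right_le_of_le (h.le i) (h.even i)))

theorem lt_of_lt (h : Interlacing a b σ) {i j : Fin l} (hij : i < j) (he : Even (a i - a j)) :
    σ i < σ j := by
  have h1 := h.anti_left hij
  have h2 := h.le i
  have h3 := h.le j
  refine h.anti_right.lt_iff_gt.1 ?_
  rcases h.disjoint i j hij.ne he with h4 | h4 <;> omega

end Interlacing

/-! ### The sign -/

/-- The sum of the products of all pairs of entries. -/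
def pairSum {l : ℕ} (x : Fin l → ℤ) : ℤ := ∑ i, ∑ j ∈ Ioi i, x i * x j

theorem two_mul_pairSum {l : ℕ} (x : Fin l → ℤ) :
    2 * pairSum x = (∑ i, x i) ^ 2 - ∑ i, x i ^ 2 := by
  have h1 : ∑ i, ∑ j ∈ Iio i, x i * x j = pairSum x := by
    rw [pairSum, sum_comm' (t' := univ) (s' := fun i => Ioi i) (by simp)]
    exact sum_congr rfl fun i _ => sum_congr rfl fun j _ => mul_comm _ _
  have h2 : ∀ i, ∑ j, x i * x j =
      ∑ j ∈ Iio i, x i * x j + x i ^ 2 + ∑ j ∈ Ioi i, x i * x j := by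
    intro i
    have h3 : (univ : Finset (Fin l)) = (Iio i).disjUnion ({i} ∪ Ioi i)
        (by rw [disjoint_left]; intro j; simp) := by
      ext j
      simp
      omega
    rw [h3, sum_disjUnion, sum_union (by simp), sum_singleton, add_assoc, sq]
  rw [sq, sum_mul_sum, sum_congr rfl fun i _ => h2 i, sum_add_distrib, sum_add_distrib, h1,
    pairSum]
  ring

theorem pairSum_comp {l : ℕ} (x : Fin l → ℤ) (σ : Equiv.Perm (Fin l)) :
    pairSum (fun i => x (σ i)) = pairSum x := by
  have h1 := two_mul_pairSum fun i => x (σ i)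
  have h2 := two_mul_pairSum x
  rw [Equiv.sum_comp σ x, Equiv.sum_comp σ fun i => x i ^ 2] at h1
  omega

/-- An antisymmetric function which compares indices first by the parities of their entries. -/
def parityCompare {l : ℕ} (x : Fin l → ℤ) (i j : Fin l) : ℤ :=
  if Even (x i - x j) then (if i < j then 1 else if j < i then -1 else 0)
  else if Even (x i) then 1 else -1

theorem parityCompare_antisymm {l : ℕ} (x : Fin l → ℤ) (i j : Fin l) :
    parityCompare x i j = -parityCompare x j i := by
  unfold parityCompare
  simp only [Int.even_iff]
  split_ifs <;> omega

theorem parityCompare_of_lt {l : ℕ} (x : Fin l → ℤ) {i j : Fin l} (hij : i < j) :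
    parityCompare x i j = ((x i + x i * x j).negOnePow : ℤˣ) := by
  unfold parityCompare
  split_ifs with h1 h2
  · rw [Int.negOnePow_even, Units.val_one]
    rw [Int.even_sub] at h1
    rw [Int.even_add, Int.even_mul]
    tauto
  · rw [Int.negOnePow_even, Units.val_one]
    exact h2.add (h2.mul_right _)
  · rw [Int.negOnePow_odd, Units.val_neg, Units.val_one]
    rw [Int.even_sub] at h1
    rw [← Int.not_even_iff_odd, Int.even_add, Int.even_mul]
    tauto

theorem negOnePow_sum {ι : Type*} (s : Finset ι) (f : ι → ℤ) :
    (∑ i ∈ s, f i).negOnePow = ∏ i ∈ s, (f i).negOnePow := by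
  classical
  induction s using Finset.induction_on with
  | empty => simp
  | insert i s hi ih => rw [sum_insert hi, prod_insert hi, Int.negOnePow_add, ih]

theorem prod_parityCompare {l : ℕ} (x : Fin l → ℤ) :
    ∏ i, ∏ j ∈ Ioi i, parityCompare x i j =
      ((∑ i : Fin l, ((l : ℤ) - 1 - (i : ℕ)) * x i + pairSum x).negOnePow : ℤˣ) := by
  have h : ∑ i : Fin l, ((l : ℤ) - 1 - (i : ℕ)) * x i + pairSum x =
      ∑ i, ∑ j ∈ Ioi i, (x i + x i * x j) := by
    rw [pairSum, ← sum_add_distrib]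
    refine sum_congr rfl fun i _ => ?_
    rw [sum_add_distrib, sum_const, Fin.card_Ioi, nsmul_eq_mul]
    have := i.2
    push_cast [Nat.sub_sub, Nat.cast_sub (show 1 + (i : ℕ) ≤ l by omega)]
    ring
  rw [h, negOnePow_sum, Units.coe_prod]
  refine prod_congr rfl fun i _ => ?_
  rw [negOnePow_sum, Units.coe_prod]
  exact prod_congr rfl fun j hj => parityCompare_of_lt x (mem_Ioi.1 hj)

theorem Interlacing.sign_eq {l : ℕ} {a b : Fin l → ℤ} {σ : Equiv.Perm (Fin l)}
    (h : Interlacing a b σ) :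
    Equiv.Perm.sign σ = (∑ i : Fin l, (i : ℕ) * a i + ∑ i : Fin l, (i : ℕ) * b i).negOnePow := by
  have hcomp : ∀ i j, parityCompare b (σ i) (σ j) = parityCompare a i j := by
    intro i j
    have hi := h.even i
    have hj := h.even j
    have e1 : Even (b (σ i) - b (σ j)) ↔ Even (a i - a j) := by
      simp only [Int.even_iff] at *
      omega
    have e2 : Even (b (σ i)) ↔ Even (a i) := by
      simp only [Int.even_iff] at *
      omega
    unfold parityCompare
    simp only [e1, e2]
    by_cases he : Even (a i - a j)
    · simp only [if_pos he]
      rcases lt_trichotomy i j with hij | rfl | hij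
      · rw [if_pos (h.lt_of_lt hij he), if_pos hij]
      · simp
      · have hlt := h.lt_of_lt hij (by rw [Int.even_iff] at *; omega)
        rw [if_neg hlt.not_gt, if_pos hlt, if_neg hij.not_gt, if_pos hij]
    · simp only [if_neg he]
  have key := σ.prod_Ioi_comp_eq_sign_mul_prod (parityCompare_antisymm b)
  simp only [hcomp, prod_parityCompare, Int.cast_id] at key
  rw [← Units.val_mul, Units.val_inj] at key
  rw [eq_mul_inv_of_mul_eq key.symm, Int.units_inv_eq_self, ← Int.negOnePow_add,
    Int.negOnePow_eq_iff]
  have hsum : Even (∑ i, a i - ∑ i, b i) := by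
    rw [← Equiv.sum_comp σ b, ← sum_sub_distrib]
    refine even_sum _ fun i _ => ?_
    have := h.even i
    rw [Int.even_iff] at *
    omega
  have hpair : Even (pairSum a - pairSum b) := by
    rw [← pairSum_comp b σ, pairSum, pairSum, ← sum_sub_distrib]
    refine even_sum _ fun i _ => ?_
    rw [← sum_sub_distrib]
    refine even_sum _ fun j _ => ?_
    have h1 : a i * a j - b (σ i) * b (σ j) =
      -((b (σ i) - a i) * a j) - b (σ i) * (b (σ j) - a j) := by ring
    rw [h1]
    exact ((h.even i).mul_right _).neg.sub ((h.even j).mul_left _)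
  have hlin : ∀ x : Fin l → ℤ, ∑ i : Fin l, ((l : ℤ) - 1 - (i : ℕ)) * x i =
      ((l : ℤ) - 1) * ∑ i, x i - ∑ i : Fin l, (i : ℕ) * x i := by
    intro x
    rw [mul_sum, ← sum_sub_distrib]
    exact sum_congr rfl fun i _ => by ring
  rw [hlin, hlin]
  obtain ⟨s, hs⟩ := hsum
  obtain ⟨t, ht⟩ := hpair
  refine ⟨((l : ℤ) - 1) * (s + ∑ i, b i) + t + pairSum b - ∑ i : Fin l, (i : ℕ) * a i -
    ∑ i : Fin l, (i : ℕ) * b i, ?_⟩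
  linear_combination ((l : ℤ) - 1) * hs + ht

/-! ### The counting function -/

/-- The number of the first `l` entries of `A` which are congruent to `c` and at most `x`, minus the
number of the first `l` entries of `B` which are congruent to `c` and less than `x`. -/
def coverCount (l : ℕ) (A B : ℕ → ℤ) (c x : ℤ) : ℤ :=
  ∑ k ∈ range l, (if Even (A k - c) ∧ A k ≤ x then 1 else 0) +
    ∑ k ∈ range l, (if Even (B k - c) ∧ B k < x then -1 else 0)

theorem Interlacing.coverCount_mem {l : ℕ} {A B : ℕ → ℤ} {σ : Equiv.Perm (Fin l)}
    (h : Interlacing (fun i : Fin l => A i) (fun i : Fin l => B i) σ) (c x : ℤ) :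
    0 ≤ coverCount l A B c x ∧ coverCount l A B c x ≤ 1 := by
  classical
  have h1 : coverCount l A B c x =
      #{i : Fin l | Even (A i - c) ∧ A i ≤ x ∧ x ≤ B (σ i)} := by
    rw [coverCount, sum_range, sum_range,
      ← Equiv.sum_comp σ fun i => (if Even (B i - c) ∧ B i < x then (-1 : ℤ) else 0),
      ← sum_add_distrib, card_filter]
    push_cast
    refine sum_congr rfl fun i _ => ?_
    have h2 := h.le i
    have h3 := h.even i
    simp only [Int.even_iff] at *
    split_ifs <;> omega
  rw [h1]
  refine ⟨by positivity, ?_⟩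
  norm_cast
  rw [card_le_one]
  intro i hi j hj
  simp only [mem_filter, mem_univ, true_and] at hi hj
  by_contra hij
  rcases h.disjoint i j hij (by simp only [Int.even_iff] at *; omega) with h3 | h3 <;> omega

theorem coverCount_lt {l : ℕ} {A B : ℕ → ℤ} {c x y : ℤ} {i : ℕ} (hi : i < l)
    (hc : Even (A i - c)) (hy : y < A i) (hx : A i ≤ x)
    (hB : ∀ m, m < l → Even (B m - c) → ¬ (y ≤ B m ∧ B m < x)) :
    coverCount l A B c y + 1 ≤ coverCount l A B c x := by
  have hb : ∑ k ∈ range l, (if Even (B k - c) ∧ B k < x then (-1 : ℤ) else 0) =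
      ∑ k ∈ range l, (if Even (B k - c) ∧ B k < y then (-1 : ℤ) else 0) := by
    refine sum_congr rfl fun k hk => ?_
    have := hB k (mem_range.1 hk)
    refine if_congr (and_congr_right fun h => ?_) rfl rfl
    have := this h
    omega
  have ha : ∑ k ∈ range l, (if Even (A k - c) ∧ A k ≤ y then (1 : ℤ) else 0) <
      ∑ k ∈ range l, (if Even (A k - c) ∧ A k ≤ x then (1 : ℤ) else 0) := by
    refine sum_lt_sum (fun k _ => ?_) ⟨i, mem_range.2 hi, ?_⟩
    · split_ifs <;> first | omega | (exfalso; simp_all; omega)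
    · rw [if_neg (by simp only [not_and]; intro; omega), if_pos ⟨hc, hx⟩]
      norm_num
  unfold coverCount
  omega

theorem exists_interlacing {l : ℕ} {A B : ℕ → ℤ} (hA : StrictAnti fun i : Fin l => A i)
    (hB : StrictAnti fun i : Fin l => B i)
    (h : ∀ c x, 0 ≤ coverCount l A B c x ∧ coverCount l A B c x ≤ 1) :
    ∃ σ, Interlacing (fun i : Fin l => A i) (fun i : Fin l => B i) σ := by
  classical
  have hpos : ∀ i : Fin l, ∃ m : Fin l, Even (B m - A i) ∧ A i ≤ B m := by
    intro i
    by_contra! hno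
    obtain ⟨X, hX⟩ : ∃ X : ℤ, ∀ k, k < l → A k < X ∧ B k < X := by
      obtain ⟨X, hX⟩ := ((range l).image A ∪ (range l).image B).bddAbove
      refine ⟨X + 1, fun k hk => ⟨?_, ?_⟩⟩
      · have := hX (show A k ∈ _ by
          simp only [coe_union, coe_image, Set.mem_union, Set.mem_image]
          exact .inl ⟨k, by simpa using hk, rfl⟩)
        omega
      · have := hX (show B k ∈ _ by
          simp only [coe_union, coe_image, Set.mem_union, Set.mem_image]
          exact .inr ⟨k, by simpa using hk, rfl⟩)
        omega
    have h1 := coverCount_lt (A := A) (B := B) (c := A i) (y := A i - 1) i.2 (by simp) (by omega)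
      (hX i i.2).1.le (fun m hm he hlt => by
        have := hno ⟨m, hm⟩ he
        have h2 : B m = A i - 1 := by
          simp only at this
          omega
        rw [h2, Int.even_iff] at he
        omega)
    have h2 : coverCount l A B (A i) X + coverCount l A B (A i + 1) X = 0 := by
      unfold coverCount
      rw [add_add_add_comm, ← sum_add_distrib, ← sum_add_distrib, ← sum_add_distrib]
      refine sum_eq_zero fun k hk => ?_
      have := hX k (mem_range.1 hk)
      simp only [Int.even_iff]
      split_ifs <;> omega
    have h3 := (h (A i) (A i - 1)).1
    have h4 := (h (A i + 1) X).1
    omega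
  have hmin : ∀ i : Fin l, ∃ m : Fin l, (Even (B m - A i) ∧ A i ≤ B m) ∧
      ∀ k : Fin l, Even (B k - A i) → A i ≤ B k → B m ≤ B k := by
    intro i
    obtain ⟨m, hm, hmin⟩ := exists_min_image (univ.filter fun m : Fin l =>
      Even (B m - A i) ∧ A i ≤ B m) (fun m : Fin l => B m) (by
        obtain ⟨m, hm⟩ := hpos i
        exact ⟨m, by simpa using hm⟩)
    exact ⟨m, by simpa using hm, fun k h1 h2 => hmin k (by simpa using ⟨h1, h2⟩)⟩
  choose τ hτ hτmin using hmin
  have hdisj : ∀ i j : Fin l, A j < A i → Even (A i - A j) → B (τ j) < A i := by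
    intro i j hlt he
    by_contra! hle
    have h1 := coverCount_lt (A := A) (B := B) (c := A i) (y := A j) i.2 (by simp) hlt le_rfl
      (fun m hm hem hlt' => by
        have := hτmin j ⟨m, hm⟩ (by simp only [Int.even_iff] at *; omega) hlt'.1
        simp only at this
        omega)
    have h2 := coverCount_lt (A := A) (B := B) (c := A i) (y := A j - 1) (x := A j) j.2
      (by simp only [Int.even_iff] at *; omega) (by omega) le_rfl (fun m hm hem hlt' => by
        have h3 : B m = A j - 1 := by omega
        rw [h3] at hem
        simp only [Int.even_iff] at *
        omega)
    have h3 := (h (A i) (A j - 1)).1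
    have h4 := (h (A i) (A i)).2
    omega
  have hinj : Function.Injective τ := by
    intro i j hij
    have hi := hτ i
    have hj := hτ j
    rw [hij] at hi
    have he : Even (A i - A j) := by
      simp only [Int.even_iff] at *
      omega
    rcases lt_trichotomy (A i) (A j) with hlt | heq | hlt
    · have := hdisj j i hlt (by simp only [Int.even_iff] at *; omega)
      rw [hij] at this
      omega
    · exact hA.injective heq
    · have := hdisj i j hlt he
      omega
  refine ⟨Equiv.ofBijective τ (Finite.injective_iff_bijective.1 hinj), hA, hB,
    fun i => (hτ i).2, fun i => (hτ i).1, fun i j hij he => ?_⟩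
  rcases lt_trichotomy (A i) (A j) with hlt | heq | hlt
  · exact .inl (hdisj j i hlt (by simp only [Int.even_iff] at *; omega))
  · exact absurd (hA.injective heq) hij
  · exact .inr (hdisj i j hlt he)

/-! ### Exchange at height `0` -/

theorem coverCount_add_coverCount (l : ℕ) (A B : ℕ → ℤ) (c x : ℤ) :
    coverCount l A B c x + coverCount l A B (c + 1) x =
      ∑ k ∈ range l, (if A k ≤ x then 1 else 0) + ∑ k ∈ range l, (if B k < x then -1 else 0) := by
  unfold coverCount
  rw [add_add_add_comm, ← sum_add_distrib, ← sum_add_distrib]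
  congr 1 <;>
  · refine sum_congr rfl fun k _ => ?_
    simp only [Int.even_iff]
    split_ifs <;> omega

theorem sum_range_ite_le {k l : ℕ} (h : k ≤ l) :
    ∑ j ∈ range l, (if k ≤ j then (1 : ℤ) else 0) = l - k := by
  induction l, h using Nat.le_induction with
  | base =>
    rw [sum_eq_zero, sub_self]
    intro j hj
    rw [if_neg (by simpa using hj)]
  | succ l hl ih =>
    rw [sum_range_succ, ih, if_pos hl]
    push_cast
    ring

section Exchange

variable {l : ℕ} {A B A' B' : ℕ → ℤ} {T : ℕ → Prop}

/-- At the indices `k` in `T`, `A k` and `B (k + 1) + 1` are exchanged. -/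
structure Exchange (l : ℕ) (A B A' B' : ℕ → ℤ) (T : ℕ → Prop) : Prop where
  lt_of_mem : ∀ k, T k → k + 1 < l
  left_of_mem : ∀ k, T k → A' k = B (k + 1) + 1
  left_of_not_mem : ∀ k, k < l → ¬ T k → A' k = A k
  right_of_mem : ∀ k, T k → B' (k + 1) = A k - 1
  right_of_not_mem : ∀ k, k + 1 < l → ¬ T k → B' (k + 1) = B (k + 1)
  right_zero : 0 < l → B' 0 = B 0

open Classical in
theorem Exchange.coverCount_eq (h : Exchange l A B A' B' T) (c x : ℤ) :
    coverCount l A' B' c x = coverCount l A B c x + ∑ k ∈ range (l - 1),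
      ((if T k ∧ B (k + 1) + 1 ≤ x ∧ x < A k then 1 else 0) -
        (if T k ∧ A k ≤ x ∧ x < B (k + 1) + 1 then 1 else 0)) := by
  refine sum_add_sum_shift l 1 (fun k hk => ?_) (fun k hk hl => ?_) (fun k hk h1 => ?_)
  · by_cases hT : T k
    · rw [h.left_of_mem k hT, h.right_of_mem k hT]
      simp only [hT, Int.even_iff, true_and]
      split_ifs <;> omega
    · rw [h.left_of_not_mem k (by omega) hT, h.right_of_not_mem k hk hT]
      simp [hT]
  · rw [h.left_of_not_mem k hk fun hT => by have := h.lt_of_mem k hT; omega]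
  · obtain rfl : k = 0 := by omega
    rw [h.right_zero hk]

theorem Exchange.coverCount_mem (h : Exchange l A B A' B' T)
    (hA : ∀ i k, i < k → k < l → A k < A i) (hB : ∀ i k, i < k → k < l → B k < B i)
    (hcov : ∀ c x, 0 ≤ coverCount l A B c x ∧ coverCount l A B c x ≤ 1)
    (hT : (∀ k, T k → A k ≤ B (k + 1) + 1) ∨ ∀ k, T k → B (k + 1) + 1 ≤ A k) (c x : ℤ) :
    0 ≤ coverCount l A' B' c x ∧ coverCount l A' B' c x ≤ 1 := by
  classical
  have hA' : ∀ i k, i ≤ k → k < l → A k ≤ A i := fun i k hik hk => by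
    rcases hik.lt_or_eq with hik | rfl
    · exact (hA i k hik hk).le
    · exact le_rfl
  have hB' : ∀ i k, i ≤ k → k < l → B k ≤ B i := fun i k hik hk => by
    rcases hik.lt_or_eq with hik | rfl
    · exact (hB i k hik hk).le
    · exact le_rfl
  have htot := coverCount_add_coverCount l A B c x
  have hneg : ∑ k ∈ range l, (if B k < x then (-1 : ℤ) else 0) =
      -∑ k ∈ range l, (if B k < x then (1 : ℤ) else 0) := by
    rw [← sum_neg_distrib]
    exact sum_congr rfl fun k _ => by split_ifs <;> rfl
  rw [hneg] at htot
  have h0 := hcov c x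
  have h1 := hcov (c + 1) x
  rw [h.coverCount_eq]
  rcases hT with hT | hT
  · have hsum : ∑ k ∈ range (l - 1), ((if T k ∧ B (k + 1) + 1 ≤ x ∧ x < A k then (1 : ℤ) else 0) -
        (if T k ∧ A k ≤ x ∧ x < B (k + 1) + 1 then 1 else 0)) =
        -(#{k ∈ range (l - 1) | T k ∧ A k ≤ x ∧ x < B (k + 1) + 1} : ℤ) := by
      rw [card_filter]
      push_cast
      rw [← sum_neg_distrib]
      refine sum_congr rfl fun k _ => ?_
      rw [if_neg (by rintro ⟨hk, h2⟩; have := hT k hk; omega)]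
      ring
    have hbound : ∀ k k', k ≤ k' → k' + 1 < l → A k ≤ x → x < B (k' + 1) + 1 →
        (2 : ℤ) + (k' - k) ≤ coverCount l A B c x + coverCount l A B (c + 1) x := by
      intro k k' hkk hk' hk hx
      have e1 : ∑ j ∈ range l, (if k ≤ j then (1 : ℤ) else 0) ≤
          ∑ j ∈ range l, (if A j ≤ x then 1 else 0) := by
        refine sum_le_sum fun j hj => ?_
        have hj := mem_range.1 hj
        have := hA' k j
        split_ifs <;> omega
      have e2 : ∑ j ∈ range l, (if B j < x then (1 : ℤ) else 0) ≤
          ∑ j ∈ range l, (if k' + 2 ≤ j then 1 else 0) := by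
        refine sum_le_sum fun j hj => ?_
        have hj := mem_range.1 hj
        have := hB' j (k' + 1)
        split_ifs <;> omega
      rw [sum_range_ite_le (by omega)] at e1 e2
      push_cast at *
      omega
    have hcard : #{k ∈ range (l - 1) | T k ∧ A k ≤ x ∧ x < B (k + 1) + 1} ≤ 1 := by
      rw [card_le_one]
      intro i hi j hj
      simp only [mem_filter, mem_range] at hi hj
      rcases lt_trichotomy i j with hij | hij | hij
      · have := hbound i j hij.le (by omega) hi.2.2.1 hj.2.2.2
        omega
      · exact hij
      · have := hbound j i hij.le (by omega) hj.2.2.1 hi.2.2.2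
        omega
    rw [hsum]
    rcases Nat.le_one_iff_eq_zero_or_eq_one.1 hcard with h2 | h2
    · rw [h2]
      simpa using h0
    · obtain ⟨k, hk⟩ := card_pos.1 (h2 ▸ Nat.one_pos)
      simp only [mem_filter, mem_range] at hk
      have := hbound k k le_rfl (by omega) hk.2.2.1 hk.2.2.2
      rw [h2]
      push_cast
      omega
  · have hsum : ∑ k ∈ range (l - 1), ((if T k ∧ B (k + 1) + 1 ≤ x ∧ x < A k then (1 : ℤ) else 0) -
        (if T k ∧ A k ≤ x ∧ x < B (k + 1) + 1 then 1 else 0)) =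
        #{k ∈ range (l - 1) | T k ∧ B (k + 1) + 1 ≤ x ∧ x < A k} := by
      rw [card_filter]
      push_cast
      refine sum_congr rfl fun k _ => ?_
      rw [if_neg (c := T k ∧ A k ≤ x ∧ x < B (k + 1) + 1)
        (by rintro ⟨hk, h2⟩; have := hT k hk; omega)]
      ring
    have hbound : ∀ k k', k ≤ k' → k' + 1 < l → B (k + 1) + 1 ≤ x → x < A k' →
        coverCount l A B c x + coverCount l A B (c + 1) x + (k' - k) ≤ 0 := by
      intro k k' hkk hk' hk hx
      have e1 : ∑ j ∈ range l, (if A j ≤ x then (1 : ℤ) else 0) ≤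
          ∑ j ∈ range l, (if k' + 1 ≤ j then 1 else 0) := by
        refine sum_le_sum fun j hj => ?_
        have hj := mem_range.1 hj
        have := hA' j k'
        split_ifs <;> omega
      have e2 : ∑ j ∈ range l, (if k + 1 ≤ j then (1 : ℤ) else 0) ≤
          ∑ j ∈ range l, (if B j < x then 1 else 0) := by
        refine sum_le_sum fun j hj => ?_
        have hj := mem_range.1 hj
        have := hB' (k + 1) j
        split_ifs <;> omega
      rw [sum_range_ite_le (by omega)] at e1 e2
      push_cast at *
      omega
    have hcard : #{k ∈ range (l - 1) | T k ∧ B (k + 1) + 1 ≤ x ∧ x < A k} ≤ 1 := by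
      rw [card_le_one]
      intro i hi j hj
      simp only [mem_filter, mem_range] at hi hj
      rcases lt_trichotomy i j with hij | hij | hij
      · have := hbound i j hij.le (by omega) hi.2.2.1 hj.2.2.2
        omega
      · exact hij
      · have := hbound j i hij.le (by omega) hj.2.2.1 hi.2.2.2
        omega
    rw [hsum]
    rcases Nat.le_one_iff_eq_zero_or_eq_one.1 hcard with h2 | h2
    · rw [h2]
      simpa using h0
    · obtain ⟨k, hk⟩ := card_pos.1 (h2 ▸ Nat.one_pos)
      simp only [mem_filter, mem_range] at hk
      have := hbound k k le_rfl (by omega) hk.2.2.1 hk.2.2.2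
      rw [h2]
      push_cast
      omega

theorem Exchange.sign_eq (h : Exchange l A B A' B' T) {σ σ' : Equiv.Perm (Fin l)}
    (hσ : Interlacing (fun i : Fin l => A i) (fun i : Fin l => B i) σ)
    (hσ' : Interlacing (fun i : Fin l => A' i) (fun i : Fin l => B' i) σ')
    (hodd : Odd {k | T k ∧ Even (A k - B (k + 1))}.ncard) :
    Equiv.Perm.sign σ' = -Equiv.Perm.sign σ := by
  classical
  have hsum := sum_add_sum_shift l 1 (u := fun k => (k : ℤ) * A k) (u' := fun k => (k : ℤ) * A' k)
    (v := fun k => (k : ℤ) * B k) (v' := fun k => (k : ℤ) * B' k)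
    (c := fun k => if T k then A k - B (k + 1) - 1 else 0) (fun k hk => by
      by_cases hT : T k
      · simp only [h.left_of_mem k hT, h.right_of_mem k hT, if_pos hT]
        push_cast
        ring
      · simp only [h.left_of_not_mem k (by omega) hT, h.right_of_not_mem k hk hT, if_neg hT]
        ring) (fun k hk hl => by
      simp only [h.left_of_not_mem k hk fun hT => by have := h.lt_of_mem k hT; omega])
    (fun k hk h1 => by
      obtain rfl : k = 0 := by omega
      simp)
  have hcard : Odd (∑ k ∈ range (l - 1), if T k then A k - B (k + 1) - 1 else 0) := by
    have h1 : {k | T k ∧ Even (A k - B (k + 1))} =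
        ((range (l - 1)).filter fun k => T k ∧ Even (A k - B (k + 1)) : Finset ℕ) := by
      ext k
      simp only [Set.mem_ofPred_eq, coe_filter, mem_range]
      refine ⟨fun hk => ⟨?_, hk⟩, fun hk => hk.2⟩
      have := h.lt_of_mem k hk.1
      omega
    rw [h1, Set.ncard_coe_finset, card_filter] at hodd
    have h2 : Odd ((∑ k ∈ range (l - 1),
        if T k ∧ Even (A k - B (k + 1)) then 1 else 0 : ℕ) : ℤ) := by exact_mod_cast hodd
    have h3 : Even (∑ k ∈ range (l - 1), (if T k then A k - B (k + 1) - 1 else 0) -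
        ((∑ k ∈ range (l - 1), if T k ∧ Even (A k - B (k + 1)) then 1 else 0 : ℕ) : ℤ)) := by
      push_cast
      rw [← sum_sub_distrib]
      refine even_sum _ fun k _ => ?_
      by_cases hT : T k
      · simp only [hT, true_and, if_true, Int.even_iff]
        split_ifs <;> omega
      · simp [hT]
    have := h3.add_odd h2
    rwa [sub_add_cancel] at this
  rw [hσ.sign_eq, hσ'.sign_eq]
  rw [sum_range, sum_range, sum_range, sum_range] at hsum
  rw [hsum, Int.negOnePow_add, Int.negOnePow_odd _ hcard, mul_neg_one]

end Exchange

/-! ### The generators of the ring of weights are units -/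

section Units

variable {n : ℕ}

theorem z_zero (s : Bool) (a : ℂ) : (z (s, 0) a : ZRing n) = 1 := by
  rw [z, ← sub_eq_zero, ← map_one (Ideal.Quotient.mk _), ← map_sub, Ideal.Quotient.eq_zero_iff_mem]
  exact Ideal.subset_span (.inr ⟨s, a, rfl⟩)

theorem z_mul_z (j : Fin n) {a a' : ℂ}
    (h : a' = a - 2 * (n : ℂ) + 2 * ((j : ℕ) + 1 : ℂ) - 4) :
    (z (false, j.succ) a * z (true, j.succ) a' : ZRing n) =
      z (false, j.castSucc) a * z (true, j.castSucc) a' := by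
  simp only [z]
  rw [← sub_eq_zero, ← map_mul, ← map_mul, ← map_sub, Ideal.Quotient.eq_zero_iff_mem]
  exact Ideal.subset_span (.inl ⟨j, a, a', h, rfl⟩)

theorem isUnit_z (i : Letter n) (a : ℂ) : IsUnit (z i a : ZRing n) := by
  obtain ⟨s, k⟩ := i
  induction k using Fin.induction generalizing a s with
  | zero =>
    rw [z_zero]
    exact isUnit_one
  | succ j ih =>
    have hunit : ∀ a a' : ℂ, a' = a - 2 * (n : ℂ) + 2 * ((j : ℕ) + 1 : ℂ) - 4 →
        IsUnit (z (false, j.succ) a * z (true, j.succ) a' : ZRing n) := by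
      intro a a' h
      rw [z_mul_z j h]
      exact (ih a false).mul (ih a' true)
    cases s with
    | false => exact isUnit_of_mul_isUnit_left (hunit a _ rfl)
    | true =>
      refine isUnit_of_mul_isUnit_right
        (hunit (a + 2 * (n : ℂ) - 2 * ((j : ℕ) + 1 : ℂ) + 4) a ?_)
      ring

/-- The generator `z_{i,a}` as a unit. -/
def zUnit (i : Letter n) (a : ℂ) : (ZRing n)ˣ := (isUnit_z i a).unit

@[simp]
theorem val_zUnit (i : Letter n) (a : ℂ) : (zUnit i a : ZRing n) = z i a := rfl

/-- The unit `z_{n+1-r,a+2x}`, or `z_{\overline{n+1-r},a+2x}`. -/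
def step (n : ℕ) (a : ℂ) (s : Bool) (r : ℕ) (x : ℤ) : (ZRing n)ˣ :=
  zUnit (s, Fin.ofNat (n + 1) (n + 1 - r)) (a + 2 * (x : ℂ))

theorem step_last (a : ℂ) (s : Bool) (x : ℤ) : step n a s (n + 1) x = 1 := by
  ext
  simp [step, z_zero]

theorem step_mul_step (a : ℂ) {r : ℕ} (h1 : 1 ≤ r) (hr : r ≤ n) (x : ℤ) :
    step n a false (r + 1) x * step n a true (r + 1) (x - 1 - r) =
      step n a false r x * step n a true r (x - 1 - r) := by
  have e1 : Fin.ofNat (n + 1) (n + 1 - r) = (⟨n - r, by omega⟩ : Fin n).succ := by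
    ext
    simp only [Fin.ofNat, Fin.val_succ]
    rw [Nat.mod_eq_of_lt] <;> omega
  have e2 : Fin.ofNat (n + 1) (n + 1 - (r + 1)) = (⟨n - r, by omega⟩ : Fin n).castSucc := by
    ext
    simp only [Fin.ofNat, Fin.val_castSucc]
    rw [Nat.mod_eq_of_lt] <;> omega
  ext
  rw [Units.val_mul, Units.val_mul, step, step, step, step, e1, e2]
  refine (z_mul_z _ ?_).symm
  push_cast [Nat.cast_sub hr]
  ring

end Units

/-! ### Potentials -/

section Potential

variable {G : Type*} [CommGroup G]

theorem exists_potential (g : ℤ → G) : ∃ F : ℤ → G, ∀ x, F (x + 1) = F x * g x := by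
  refine ⟨fun x => (∏ k ∈ range x.toNat, g k) / ∏ k ∈ range (-x).toNat, g (-(k : ℤ) - 1),
    fun x => ?_⟩
  beta_reduce
  rcases lt_or_ge x 0 with hx | hx
  · obtain ⟨m, rfl⟩ : ∃ m : ℕ, x = -(m : ℤ) - 1 := ⟨(-x - 1).toNat, by omega⟩
    rw [show (-(m : ℤ) - 1 + 1).toNat = 0 by omega, show (-(m : ℤ) - 1).toNat = 0 by omega,
      show (-(-(m : ℤ) - 1 + 1)).toNat = m by omega,
      show (-(-(m : ℤ) - 1)).toNat = m + 1 by omega, prod_range_succ]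
    simp
  · obtain ⟨m, rfl⟩ := Int.eq_ofNat_of_zero_le hx
    rw [show ((m : ℤ) + 1).toNat = m + 1 by omega, show ((m : ℤ)).toNat = m by omega,
      show (-((m : ℤ) + 1)).toNat = 0 by omega, show (-(m : ℤ)).toNat = 0 by omega,
      prod_range_succ]
    simp

/-- A function with prescribed quotients of consecutive values. -/
def potential (g : ℤ → G) : ℤ → G := (exists_potential g).choose

theorem potential_succ (g : ℤ → G) (x : ℤ) : potential g (x + 1) = potential g x * g x :=
  (exists_potential g).choose_spec x

/-- A function with `F (x + 2) = F x * g x` for all `x`. -/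
def potentialTwo (g : ℤ → G) (x : ℤ) : G := potential (fun k => g (2 * k + x % 2)) (x / 2)

theorem potentialTwo_add_two (g : ℤ → G) (x : ℤ) :
    potentialTwo g (x + 2) = potentialTwo g x * g x := by
  rw [potentialTwo, show (x + 2) % 2 = x % 2 by omega, show (x + 2) / 2 = x / 2 + 1 by omega,
    potential_succ, potentialTwo, show 2 * (x / 2) + x % 2 = x by omega]

theorem prod_eq_div_of_succ {F g : ℤ → G} (h : ∀ x, F (x + 1) = F x * g x) (x : ℤ) (m : ℕ) :
    ∏ k ∈ range m, g (x + k) = F (x + m) / F x := by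
  induction m with
  | zero => simp
  | succ m ih =>
    rw [prod_range_succ, ih, Nat.cast_succ, ← add_assoc, h, div_mul_eq_mul_div]

theorem eq_of_succ_eq {α : Type*} {f : ℤ → α} (h : ∀ x, f (x + 1) = f x) (x y : ℤ) :
    f x = f y := by
  have h0 : ∀ x, f x = f 0 := by
    intro x
    induction x using Int.induction_on with
    | zero => rfl
    | succ k ih => rw [h, ih]
    | pred k ih => rw [← ih, ← h (-(k : ℤ) - 1), sub_add_cancel]
  rw [h0 x, h0 y]

end Potential

/-! ### The weight in terms of the positions -/

/-- Elements of a commutative group which are mapped to the weights of the E-steps at height `-r`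
(`s = false`) or `r` (`s = true`) starting at the horizontal position `x`, with the relations
between them. -/
structure StepSystem (n : ℕ) (a : ℂ) (G : Type*) [CommGroup G] where
  /-- the elements -/
  step : Bool → ℕ → ℤ → G
  step_last : ∀ s x, step s (n + 1) x = 1
  step_mul_step : ∀ r, 1 ≤ r → r ≤ n → ∀ x,
    step false (r + 1) x * step true (r + 1) (x - 1 - r) =
      step false r x * step true r (x - 1 - r)
  /-- the value in the ring of weights -/
  val : G →* ZRing n
  val_step : ∀ s r x, val (step s r x) =
    z (s, Fin.ofNat (n + 1) (n + 1 - r)) (a + 2 * (x : ℂ))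

/-- The system of the generators, as units of the ring of weights. -/
def unitSteps (n : ℕ) (a : ℂ) : StepSystem n a (ZRing n)ˣ where
  step := step n a
  step_last := step_last a
  step_mul_step _ h1 hr := step_mul_step a h1 hr
  val := Units.coeHom (ZRing n)
  val_step _ _ _ := rfl

section Weight

variable {n : ℕ} {a : ℂ} {G : Type*} [CommGroup G]

namespace StepSystem

variable (S : StepSystem n a G)

/-- The potential of the E-steps at height `-r` (`s = false`) or `r` (`s = true`). -/
def pot (s : Bool) (r : ℕ) : ℤ → G :=
  if r = 0 then potentialTwo fun x => S.step true 1 x * S.step false 1 (x + 1)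
  else if r ≤ n then potential (S.step s r) else fun _ => 1

theorem pot_last (s : Bool) (x : ℤ) : S.pot s (n + 1) x = 1 := by
  simp [pot]

theorem pot_zero (s : Bool) (x : ℤ) : S.pot s 0 (x + 2) =
    S.pot s 0 x * (S.step true 1 x * S.step false 1 (x + 1)) := by
  simp only [pot, if_true]
  exact potentialTwo_add_two _ x

theorem pot_succ (s : Bool) {r : ℕ} (h1 : 1 ≤ r) (hr : r ≤ n + 1) (x : ℤ) :
    S.pot s r (x + 1) = S.pot s r x * S.step s r x := by
  rcases hr.lt_or_eq with hr | rfl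
  · simp only [pot, if_neg (show r ≠ 0 by omega), if_pos (show r ≤ n by omega)]
    exact potential_succ _ x
  · rw [pot_last, pot_last, S.step_last, one_mul]

/-- The contribution of the position at height `-r` of a lower path. -/
def lowerFactor (r : ℕ) (x : ℤ) : G := S.pot false (r + 1) x / S.pot false r x

/-- The contribution of the position at height `r` of an upper path. -/
def upperFactor (r : ℕ) (x : ℤ) : G := S.pot true r x / S.pot true (r + 1) x

theorem lowerFactor_mul_upperFactor {r : ℕ} (hr : r ≤ n) (x y : ℤ) :
    S.lowerFactor r x * S.upperFactor r (y - 1 - r) =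
      S.lowerFactor r y * S.upperFactor r (x - 1 - r) := by
  let f : ℤ → G := fun x => S.pot false (r + 1) x * S.pot true (r + 1) (x - 1 - r) /
    (S.pot false r x * S.pot true r (x - 1 - r))
  have key : ∀ x : ℤ, f (x + 1) = f x := by
    intro x
    simp only [f]
    rw [show x + 1 - 1 - (r : ℤ) = x - 1 - r + 1 by ring, S.pot_succ _ (by omega) (by omega),
      S.pot_succ _ (by omega) (by omega), div_eq_div_iff_mul_eq_mul]
    rcases Nat.eq_zero_or_pos r with rfl | h1
    · have h2 := S.pot_zero false (x - 1)
      rw [show x - 1 + 2 = x + 1 by ring, sub_add_cancel] at h2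
      rw [h2]
      have h3 : S.pot true 0 = S.pot false 0 := rfl
      simp only [Nat.cast_zero, sub_zero, sub_add_cancel, h3, zero_add]
      ac_rfl
    · rw [S.pot_succ _ h1 (by omega), S.pot_succ _ h1 (by omega)]
      have h2 := S.step_mul_step r h1 hr x
      calc _ = S.pot false (r + 1) x * S.pot true (r + 1) (x - 1 - r) *
            S.pot false r x * S.pot true r (x - 1 - r) *
            (S.step false (r + 1) x * S.step true (r + 1) (x - 1 - r)) := by ac_rfl
        _ = _ := by
          rw [h2]
          ac_rfl
  have := eq_of_succ_eq key x y
  simp only [f, div_eq_div_iff_mul_eq_mul] at this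
  rw [lowerFactor, upperFactor, lowerFactor, upperFactor, div_mul_div_comm, div_mul_div_comm,
    div_eq_div_iff_mul_eq_mul]
  calc _ = S.pot false (r + 1) x * S.pot true (r + 1) (x - 1 - r) *
        (S.pot false r y * S.pot true r (y - 1 - r)) := by ac_rfl
    _ = _ := by
      rw [this]
      ac_rfl

end StepSystem

theorem prod_Icc_neg {M : Type*} [CommMonoid M] (n : ℕ) (W : ℤ → M) :
    ∏ y ∈ Icc (-(n : ℤ)) n, W y =
      (∏ r ∈ range n, W (-(r : ℤ) - 1)) * W 0 * ∏ r ∈ range n, W ((r : ℤ) + 1) := by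
  induction n with
  | zero => simp
  | succ n ih =>
    have h : Icc (-((n + 1 : ℕ) : ℤ)) ((n + 1 : ℕ) : ℤ) =
        insert (-(n : ℤ) - 1) (insert ((n : ℤ) + 1) (Icc (-(n : ℤ)) n)) := by
      ext y
      simp only [mem_insert, mem_Icc]
      push_cast
      omega
    rw [h, prod_insert (by simp only [mem_insert, mem_Icc]; omega),
      prod_insert (by simp only [mem_Icc]; omega), ih, prod_range_succ, prod_range_succ]
    ac_rfl

namespace LatticePath

variable {b t : ℤ}

theorem left_succ (p : LatticePath b t) {y : ℤ} (h : b ≤ y) : p.left (y + 1) = p.right y := by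
  rw [right, left, left, add_assoc, ← Finset.insert_Ico_right_eq_Ico_add_one h,
    sum_insert (by simp), add_comm ((p.east y : ℤ))]

theorem left_eq (p : LatticePath b t) {y : ℤ} (h : b < y) : p.left y = p.right (y - 1) := by
  rw [← p.left_succ (by omega), sub_add_cancel]

theorem right_bot (p : LatticePath b t) : p.right b = p.start := by
  rw [right, p.east_eq_zero b (by omega), left]
  simp

theorem left_bot (p : LatticePath b t) : p.left b = p.start := by
  simp [left]

theorem left_le_right (p : LatticePath b t) (y : ℤ) : p.left y ≤ p.right y := by
  rw [right]
  omega

end LatticePath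

namespace CPath

theorem left_neg (c : CPath n) {r : ℕ} (hr : r ≤ n) :
    c.left (-(r : ℤ)) = c.right (-(r : ℤ) - 1) :=
  c.left_eq (by omega)

theorem left_natCast_succ (c : CPath n) (r : ℕ) : c.left ((r : ℤ) + 1) = c.right r :=
  c.left_succ (by omega)

theorem weight_eq (S : StepSystem n a G) (c : CPath n) :
    c.weight a = S.val ((∏ r ∈ range (n + 1), S.lowerFactor r (c.left (-(r : ℤ)))) *
      ∏ r ∈ range (n + 1), S.upperFactor r (c.right r)) := by
  have hlow : ∀ r, r < n → ∏ k ∈ range (c.east (-(r : ℤ) - 1)),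
      z (label n (-(r : ℤ) - 1) k) (a + 2 * ((c.left (-(r : ℤ) - 1) + (k : ℤ) : ℤ) : ℂ)) =
      S.val (S.pot false (r + 1) (c.left (-(r : ℤ))) /
        S.pot false (r + 1) (c.left (-((r + 1 : ℕ) : ℤ)))) := by
    intro r hr
    rw [c.left_neg hr.le, LatticePath.right, Nat.cast_succ, neg_add', ← prod_eq_div_of_succ
      (S.pot_succ false (r := r + 1) (by omega) (by omega)), map_prod]
    refine prod_congr rfl fun k _ => ?_
    rw [S.val_step, label, if_pos (by omega),
      show (-(r : ℤ) - 1).natAbs = r + 1 by omega]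
  have hup : ∀ r, r < n → ∏ k ∈ range (c.east ((r : ℤ) + 1)),
      z (label n ((r : ℤ) + 1) k) (a + 2 * ((c.left ((r : ℤ) + 1) + (k : ℤ) : ℤ) : ℂ)) =
      S.val (S.pot true (r + 1) (c.right ((r + 1 : ℕ) : ℤ)) /
        S.pot true (r + 1) (c.right r)) := by
    intro r hr
    rw [← c.left_natCast_succ r, Nat.cast_succ, LatticePath.right, ← prod_eq_div_of_succ
      (S.pot_succ true (r := r + 1) (by omega) (by omega)), map_prod]
    refine prod_congr rfl fun k _ => ?_
    rw [S.val_step, label, if_neg (by omega), if_neg (by omega),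
      show ((r : ℤ) + 1).natAbs = r + 1 by omega]
  have hzero : ∏ k ∈ range (c.east 0), z (label n 0 k) (a + 2 * ((c.left 0 + (k : ℤ) : ℤ) : ℂ)) =
      S.val (S.pot true 0 (c.right ((0 : ℕ) : ℤ)) /
        S.pot false 0 (c.left (-((0 : ℕ) : ℤ)))) := by
    have hgen : ∀ m : ℕ, ∏ k ∈ range (2 * m),
        z (label n 0 k) (a + 2 * ((c.left 0 + (k : ℤ) : ℤ) : ℂ)) =
        S.val (S.pot true 0 (c.left 0 + (2 * m : ℕ)) / S.pot false 0 (c.left 0)) := by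
      intro m
      induction m with
      | zero =>
        have h3 : S.pot true 0 = S.pot false 0 := rfl
        simp [h3]
      | succ m ih =>
        have hl : ∀ s, (s, Fin.last n) = ((s, Fin.ofNat (n + 1) (n + 1 - 1)) : Letter n) := by
          intro s
          congr 1
          ext
          simp [Fin.ofNat]
        rw [show 2 * (m + 1) = 2 * m + 1 + 1 by ring, prod_range_succ, prod_range_succ, ih,
          show c.left 0 + ((2 * m + 1 + 1 : ℕ) : ℤ) = c.left 0 + (2 * m : ℕ) + 2 by
            push_cast; ring, S.pot_zero, mul_div_right_comm, map_mul, mul_assoc]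
        congr 1
        rw [map_mul]
        congr 1
        · rw [label, if_neg (lt_irrefl _), if_pos rfl,
            if_neg (by rw [Nat.not_odd_iff_even]; exact even_two_mul m), hl, S.val_step]
        · rw [label, if_neg (lt_irrefl _), if_pos rfl, if_pos (odd_two_mul_add_one m), hl, S.val_step]
          congr 2
          push_cast
          ring
    obtain ⟨m, hm⟩ := c.even_east
    rw [← two_mul] at hm
    rw [Nat.cast_zero, neg_zero, LatticePath.right, hm, ← hgen]
  rw [weight, prod_Icc_neg, hzero, prod_congr rfl fun r hr => hlow r (mem_range.1 hr),
    prod_congr rfl fun r hr => hup r (mem_range.1 hr), ← map_prod, ← map_prod, ← map_mul, ← map_mul]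
  congr 1
  simp only [StepSystem.lowerFactor, StepSystem.upperFactor, prod_div_distrib]
  rw [prod_range_succ (fun r => S.pot false (r + 1) (c.left (-(r : ℤ)))),
    prod_range_succ' (fun r => S.pot false r (c.left (-(r : ℤ)))),
    prod_range_succ (fun r => S.pot true (r + 1) (c.right r)),
    prod_range_succ' (fun r => S.pot true r (c.right r)), S.pot_last, S.pot_last]
  have hgrp : ∀ a b p q c d : G, a / b * (p / q) * (c / d) =
      a * 1 / (b * q) * (c * p / (d * 1)) := by
    intro a b p q c d
    rw [div_mul_div_comm, div_mul_div_comm, div_mul_div_comm, div_eq_div_iff_mul_eq_mul]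
    simp only [mul_one]
    ac_rfl
  exact hgrp _ _ _ _ _ _

end CPath

end Weight

namespace HalfPaths

variable {n l : ℕ} {a : ℂ} {G : Type*} [CommGroup G] {q q' : HalfPaths n l} {V : Set LatticeUnit}

/-- The product of the contributions of all positions. -/
def posWeight (S : StepSystem n a G) (q : HalfPaths n l) : G :=
  ∏ r ∈ range (n + 1), ((∏ k ∈ range l, S.lowerFactor r (q.lo (k + 1) r)) *
    ∏ k ∈ range l, S.upperFactor r (q.up (k + 1) r))

theorem IsSwap.posWeight_eq (S : StepSystem n a G) (h : IsSwap q q' V) :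
    q'.posWeight S = q.posWeight S := by
  refine prod_congr rfl fun r hr => ?_
  have hr : r ≤ n := Nat.lt_succ_iff.1 (mem_range.1 hr)
  rw [prod_mul_prod_shift l (r + 1) (c := fun _ => 1)
    (u := fun k => S.lowerFactor r (q.lo (k + 1) r))
    (v := fun k => S.upperFactor r (q.up (k + 1) r)), prod_const_one, mul_one]
  · intro k hk
    rw [mul_one, show k + (r + 1) + 1 = k + 1 + 1 + r by ring]
    have h1 : ∀ p : HalfPaths n l, p.up (k + 1 + 1 + r) r = p.dual (k + 1) r - 1 - r := by
      intro p
      rw [dual]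
      ring
    rw [h1, h1]
    rcases h.strip (j := k + 1) (r := r) (by omega) (by omega) hr with ⟨h2, h3⟩ | ⟨h2, h3⟩
    · rw [h2, h3]
    · rw [h2, h3]
      exact S.lowerFactor_mul_upperFactor hr _ _
  · intro k hk hl
    rw [h.lo_of_lt (by omega) (by omega) (by omega) hr]
  · intro k hk hl
    rw [h.up_of_le (by omega) (by omega) (by omega) hr]

end HalfPaths

/-! ### Paths in terms of the positions -/

namespace LatticePath

variable {b t : ℤ}

theorem right_succ (p : LatticePath b t) {y : ℤ} (h : b ≤ y) :
    p.right (y + 1) = p.right y + p.east (y + 1) := by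
  rw [right, p.left_succ h]

theorem ext_right {p q : LatticePath b t} (h : ∀ y, b ≤ y → y < t → p.right y = q.right y)
    (hbt : b < t) : p = q := by
  ext y
  · rw [← p.right_bot, ← q.right_bot, h b le_rfl hbt]
  · by_cases hy : b < y ∧ y < t
    · have h1 := h (y - 1) (by omega) (by omega)
      have h2 := h y hy.1.le hy.2
      rw [← sub_add_cancel y 1, p.right_succ (by omega), q.right_succ (by omega), h1] at h2
      simpa using h2
    · rw [p.east_eq_zero y hy, q.east_eq_zero y hy]

end LatticePath

namespace CPath

variable {n : ℕ}

theorem left_neg_last (c : CPath n) : c.left (-(n : ℤ)) = c.start := by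
  rw [c.left_neg le_rfl]
  exact c.right_bot

theorem right_last (c : CPath n) : c.right ((n : ℤ) + 1) = c.right n := by
  rw [c.right_succ (by omega), c.east_eq_zero _ (by omega)]
  simp

theorem left_neg_succ (c : CPath n) {r : ℕ} (hr : r < n) :
    c.left (-((r + 1 : ℕ) : ℤ)) ≤ c.left (-(r : ℤ)) := by
  rw [c.left_neg hr.le, show -(r : ℤ) - 1 = -((r + 1 : ℕ) : ℤ) by push_cast; ring]
  exact c.left_le_right _

theorem right_natCast_succ (c : CPath n) (r : ℕ) : c.right r ≤ c.right ((r + 1 : ℕ) : ℤ) := by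
  rw [Nat.cast_succ, c.right_succ (by omega)]
  omega

theorem ext_positions {c d : CPath n} (h : ∀ r : ℕ, r ≤ n → c.left (-(r : ℤ)) = d.left (-(r : ℤ)))
    (h' : ∀ r : ℕ, r ≤ n → c.right r = d.right r) : c = d := by
  have : c.toLatticePath = d.toLatticePath := by
    refine LatticePath.ext_right (fun y hb ht => ?_) (by omega)
    rcases lt_or_ge y 0 with hy | hy
    · obtain ⟨r, rfl⟩ : ∃ r : ℕ, y = -(r : ℤ) - 1 := ⟨(-y - 1).toNat, by omega⟩
      rw [← c.left_neg (by omega), ← d.left_neg (by omega)]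
      exact h r (by omega)
    · obtain ⟨r, rfl⟩ := Int.eq_ofNat_of_zero_le hy
      exact h' r (by omega)
  cases c
  cases d
  simpa using this

theorem lowerPart_left (c : CPath n) (r : ℕ) : c.lowerPart.left (-(r : ℤ)) = c.left (-(r : ℤ)) := by
  rw [LatticePath.left, LatticePath.left]
  congr 1
  refine sum_congr rfl fun y hy => ?_
  have := mem_Ico.1 hy
  simp only [lowerPart]
  rw [if_pos (by omega)]

theorem upperPart_right (c : CPath n) (r : ℕ) : c.upperPart.right (r : ℤ) = c.right r := by
  induction r with
  | zero => exact c.upperPart.right_bot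
  | succ r ih =>
    rw [Nat.cast_succ, LatticePath.right_succ _ (by omega), LatticePath.right_succ _ (by omega), ih]
    simp only [upperPart]
    rw [if_pos (by omega)]

/-- The rightmost positions of the path with the given positions `A r` at height `-r` and `B r` at
height `r`. -/
def profile (A B : ℕ → ℤ) (y : ℤ) : ℤ := if y < 0 then A (-y - 1).toNat else B y.toNat

/-- The path with leftmost positions `A r` at height `-r` and rightmost positions `B r` at height
`r`. -/
def ofPositions (A B : ℕ → ℤ) (he : Even (B 0 - A 0)) : CPath n where
  start := A n
  east y := if -(n : ℤ) - 1 < y ∧ y < (n : ℤ) + 1 then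
    (profile A B y - profile A B (y - 1)).toNat else 0
  east_eq_zero y hy := if_neg hy
  even_east := by
    rw [if_pos (by omega)]
    have : profile A B 0 - profile A B (0 - 1) = B 0 - A 0 := by
      simp [profile]
    rw [this]
    rw [Int.even_iff] at he
    rw [Nat.even_iff]
    omega

section OfPositions

variable {A B : ℕ → ℤ} {he : Even (B 0 - A 0)}

theorem ofPositions_right (hle : A 0 ≤ B 0) (hA : ∀ r, r < n → A (r + 1) ≤ A r) (hB : ∀ r, r < n → B r ≤ B (r + 1))
    {y : ℤ} (hb : -(n : ℤ) - 1 ≤ y) (hy : y < (n : ℤ) + 1) :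
    (ofPositions (n := n) A B he).right y = profile A B y := by
  induction y, hb using Int.leInduction with
  | base =>
    rw [LatticePath.right_bot, profile, if_pos (by omega)]
    change A n = A _
    congr 1
    omega
  | succ y hb ih =>
    have hmono : profile A B y ≤ profile A B (y + 1) := by
      unfold profile
      rcases lt_trichotomy y (-1) with h | rfl | h
      · rw [if_pos (by omega), if_pos (by omega)]
        have := hA (-(y + 1) - 1).toNat (by omega)
        rwa [show (-(y + 1) - 1).toNat + 1 = (-y - 1).toNat by omega] at this
      · simpa using hle
      · rw [if_neg (by omega), if_neg (by omega)]
        have := hB y.toNat (by omega)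
        rwa [show y.toNat + 1 = (y + 1).toNat by omega] at this
    rw [LatticePath.right_succ _ hb, ih (by omega)]
    simp only [ofPositions]
    rw [if_pos (by omega), add_sub_cancel_right]
    omega

theorem ofPositions_left_neg (hle : A 0 ≤ B 0) (hA : ∀ r, r < n → A (r + 1) ≤ A r)
    (hB : ∀ r, r < n → B r ≤ B (r + 1)) {r : ℕ} (hr : r ≤ n) :
    (ofPositions (n := n) A B he).left (-(r : ℤ)) = A r := by
  rw [left_neg _ hr, ofPositions_right hle hA hB (by omega) (by omega), profile, if_pos (by omega)]
  congr 1
  omega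

theorem ofPositions_right_natCast (hle : A 0 ≤ B 0) (hA : ∀ r, r < n → A (r + 1) ≤ A r)
    (hB : ∀ r, r < n → B r ≤ B (r + 1)) {r : ℕ} (hr : r ≤ n) :
    (ofPositions (n := n) A B he).right r = B r := by
  rw [ofPositions_right hle hA hB (by omega) (by omega), profile, if_neg (by omega)]
  congr 1

end OfPositions

end CPath

/-! ### Tuples of paths in terms of the positions -/

theorem rowLen_le_of_depth_le {lam mu : YoungDiagram} {m : ℕ} (h : depth lam mu ≤ m) (i : ℕ) :
    lam.rowLen (i + m) ≤ mu.rowLen i := by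
  by_contra! hlt
  have h1 : mu.rowLen i < lam.rowLen 0 := hlt.trans_le (lam.rowLen_anti 0 _ (Nat.zero_le _))
  have h2 := (le_sup (f := fun j => lam.colLen j - mu.colLen j) (mem_range.2 h1)).trans h
  have h3 : i + m < lam.colLen (mu.rowLen i) :=
    YoungDiagram.mem_iff_lt_colLen.1 (YoungDiagram.mem_iff_lt_rowLen.2 hlt)
  have h4 : ¬ i < mu.colLen (mu.rowLen i) := fun h =>
    lt_irrefl _ (YoungDiagram.mem_iff_lt_rowLen.1 (YoungDiagram.mem_iff_lt_colLen.2 h))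
  omega

namespace PathTuple

variable {n : ℕ} {lam mu : YoungDiagram}

theorem lo_succ (p : PathTuple n lam mu) (i : Fin (lam.colLen 0)) (r : ℕ) :
    p.toHalfPaths.lo (i + 1) r = (p.path i).left (-(r : ℤ)) := by
  rw [HalfPaths.lo, dif_pos ⟨by omega, i.2⟩]
  exact (p.path i).lowerPart_left r

theorem up_succ (p : PathTuple n lam mu) (i : Fin (lam.colLen 0)) (r : ℕ) :
    p.toHalfPaths.up (i + 1) r = (p.path (p.perm.symm i)).right (r : ℤ) := by
  rw [HalfPaths.up, dif_pos ⟨by omega, i.2⟩]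
  exact (p.path (p.perm.symm i)).upperPart_right r

theorem up_perm_succ (p : PathTuple n lam mu) (i : Fin (lam.colLen 0)) (r : ℕ) :
    p.toHalfPaths.up (p.perm i + 1) r = (p.path i).right (r : ℤ) := by
  rw [up_succ, Equiv.symm_apply_apply]

theorem lo_last (p : PathTuple n lam mu) (i : Fin (lam.colLen 0)) :
    p.toHalfPaths.lo (i + 1) n = (mu.rowLen i : ℤ) - (i : ℕ) := by
  rw [lo_succ, CPath.left_neg_last, p.start_eq]

theorem up_last (p : PathTuple n lam mu) (i : Fin (lam.colLen 0)) :
    p.toHalfPaths.up (i + 1) n = (lam.rowLen i : ℤ) - (i : ℕ) := by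
  rw [up_succ, ← CPath.right_last, p.end_eq, Equiv.apply_symm_apply]

theorem weight_eq {a : ℂ} {G : Type*} [CommGroup G] (S : StepSystem n a G)
    (p : PathTuple n lam mu) : p.weight a = S.val (p.toHalfPaths.posWeight S) := by
  rw [weight, prod_congr rfl fun i _ => (p.path i).weight_eq S, ← map_prod, prod_mul_distrib,
    prod_comm, prod_comm (f := fun i r => S.upperFactor r ((p.path i).right r)),
    ← prod_mul_distrib, HalfPaths.posWeight]
  congr 1
  refine prod_congr rfl fun r _ => ?_
  congr 1
  · rw [prod_range]
    exact prod_congr rfl fun i _ => by rw [lo_succ]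
  · rw [prod_range, ← Equiv.prod_comp p.perm
      (fun i => S.upperFactor r (p.toHalfPaths.up (i + 1) r))]
    exact prod_congr rfl fun i _ => by rw [up_perm_succ]

theorem ext_positions {p q : PathTuple n lam mu} (hperm : p.perm = q.perm)
    (hlo : ∀ i r, 1 ≤ i → i ≤ lam.colLen 0 → r ≤ n → p.toHalfPaths.lo i r = q.toHalfPaths.lo i r)
    (hup : ∀ i r, 1 ≤ i → i ≤ lam.colLen 0 → r ≤ n →
      p.toHalfPaths.up i r = q.toHalfPaths.up i r) : p = q := by
  have hpath : p.path = q.path := by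
    funext i
    refine CPath.ext_positions (fun r hr => ?_) (fun r hr => ?_)
    · rw [← lo_succ, ← lo_succ]
      exact hlo _ _ (by omega) i.2 hr
    · rw [← up_perm_succ, ← up_perm_succ, ← hperm]
      exact hup _ _ (by omega) (p.perm i).2 hr
  cases p
  cases q
  simp_all

section NoOrdinary

variable {p : PathTuple n lam mu}

theorem NoOrdinary.special (hp : p.NoOrdinary) {i j : Fin (lam.colLen 0)} (hij : i ≠ j) {x y : ℤ}
    (hi : (p.path i).Passes x y) (hj : (p.path j).Passes x y) :
    y = 0 ∧ Odd ((p.path i).left 0 - (p.path j).left 0) := by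
  have h : CPath.SpeciallyIntersecting (p.path i) (p.path j) := by
    by_contra h
    exact hp i j hij ⟨⟨x, y, hi, hj⟩, h⟩
  exact ⟨h.2.1 x y hi hj, h.2.2⟩

theorem NoOrdinary.interlacing (hp : p.NoOrdinary)
    (hlo : StrictAnti fun i : Fin (lam.colLen 0) => p.toHalfPaths.lo (i + 1) 0)
    (hup : StrictAnti fun i : Fin (lam.colLen 0) => p.toHalfPaths.up (i + 1) 0) :
    Interlacing (fun i : Fin (lam.colLen 0) => p.toHalfPaths.lo (i + 1) 0)
      (fun i : Fin (lam.colLen 0) => p.toHalfPaths.up (i + 1) 0) p.perm := by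
  have h1 : ∀ i : Fin (lam.colLen 0), p.toHalfPaths.lo (i + 1) 0 = (p.path i).left 0 := by
    intro i
    rw [lo_succ]
    simp
  have h2 : ∀ i : Fin (lam.colLen 0),
      p.toHalfPaths.up (p.perm i + 1) 0 = (p.path i).right 0 := by
    intro i
    rw [up_perm_succ]
    simp
  refine ⟨hlo, hup, fun i => ?_, fun i => ?_, fun i j hij he => ?_⟩
  · simp only [h1, h2]
    exact LatticePath.left_le_right _ _
  · simp only [h1, h2, LatticePath.right, add_sub_cancel_left]
    exact_mod_cast (p.path i).even_east
  · simp only [h1, h2] at he ⊢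
    by_contra! hlt
    have hi := (p.path i).left_le_right 0
    have hj := (p.path j).left_le_right 0
    have := hp.special hij (x := max ((p.path i).left 0) ((p.path j).left 0)) (y := 0)
      ⟨by omega, by omega, le_max_left _ _, max_le hi hlt.1⟩
      ⟨by omega, by omega, le_max_right _ _, max_le hlt.2 hj⟩
    exact (Int.not_odd_iff_even.2 he) this.2

theorem NoOrdinary.lo_step (hp : p.NoOrdinary) {i j : Fin (lam.colLen 0)} (hij : i ≠ j) {r : ℕ}
    (hr : r < n) (h : p.toHalfPaths.lo (j + 1) (r + 1) < p.toHalfPaths.lo (i + 1) (r + 1)) :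
    p.toHalfPaths.lo (j + 1) r < p.toHalfPaths.lo (i + 1) (r + 1) := by
  rw [lo_succ, lo_succ] at *
  by_contra! hle
  have hright : ∀ k, (p.path k).right (-((r + 1 : ℕ) : ℤ)) = (p.path k).left (-(r : ℤ)) := by
    intro k
    rw [CPath.left_neg _ hr.le, Nat.cast_succ, neg_add']
  have := (hp.special hij (x := (p.path i).left (-((r + 1 : ℕ) : ℤ))) (y := -((r + 1 : ℕ) : ℤ))
    ⟨by omega, by omega, le_rfl, LatticePath.left_le_right _ _⟩
    ⟨by omega, by omega, h.le, by rwa [hright]⟩).1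
  omega

theorem NoOrdinary.up_step (hp : p.NoOrdinary) {i j : Fin (lam.colLen 0)} (hij : i ≠ j) {r : ℕ}
    (hr : r < n) (h : p.toHalfPaths.up (j + 1) (r + 1) < p.toHalfPaths.up (i + 1) (r + 1)) :
    p.toHalfPaths.up (j + 1) (r + 1) < p.toHalfPaths.up (i + 1) r := by
  rw [up_succ, up_succ] at *
  by_contra! hle
  have hleft : ∀ k, (p.path k).left ((r + 1 : ℕ) : ℤ) = (p.path k).right r := by
    intro k
    rw [Nat.cast_succ, CPath.left_natCast_succ]
  have := (hp.special (fun h => hij (p.perm.symm.injective h))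
    (x := (p.path (p.perm.symm j)).right ((r + 1 : ℕ) : ℤ)) (y := ((r + 1 : ℕ) : ℤ))
    ⟨by omega, by omega, by rwa [hleft], h.le⟩
    ⟨by omega, by omega, LatticePath.left_le_right _ _, le_rfl⟩).1
  omega

theorem NoOrdinary.isNoncrossing (hp : p.NoOrdinary) (hd : depth lam mu ≤ n + 1) :
    p.toHalfPaths.IsNoncrossing := by
  have hlast : ∀ i, 1 ≤ i → i + 1 ≤ lam.colLen 0 →
      p.toHalfPaths.lo (i + 1) n < p.toHalfPaths.lo i n := by
    intro i hi hl
    obtain ⟨k, rfl⟩ := Nat.exists_eq_add_of_le' hi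
    have h1 := p.lo_last ⟨k, by omega⟩
    have h2 := p.lo_last ⟨k + 1, by omega⟩
    have := mu.rowLen_anti k (k + 1) (by omega)
    simp only at h1 h2
    omega
  have ulast : ∀ i, 1 ≤ i → i + 1 ≤ lam.colLen 0 →
      p.toHalfPaths.up (i + 1) n < p.toHalfPaths.up i n := by
    intro i hi hl
    obtain ⟨k, rfl⟩ := Nat.exists_eq_add_of_le' hi
    have h1 := p.up_last ⟨k, by omega⟩
    have h2 := p.up_last ⟨k + 1, by omega⟩
    have := lam.rowLen_anti k (k + 1) (by omega)
    simp only at h1 h2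
    omega
  have hmono : ∀ i r, 1 ≤ i → i ≤ lam.colLen 0 → r < n →
      p.toHalfPaths.lo i (r + 1) ≤ p.toHalfPaths.lo i r := by
    intro i r hi hl hr
    obtain ⟨k, rfl⟩ := Nat.exists_eq_add_of_le' hi
    have h1 := p.lo_succ ⟨k, by omega⟩
    simp only at h1
    rw [h1, h1]
    exact CPath.left_neg_succ _ hr
  have umono : ∀ i r, 1 ≤ i → i ≤ lam.colLen 0 → r < n →
      p.toHalfPaths.up i r ≤ p.toHalfPaths.up i (r + 1) := by
    intro i r hi hl hr
    obtain ⟨k, rfl⟩ := Nat.exists_eq_add_of_le' hi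
    have h1 := p.up_succ ⟨k, by omega⟩
    simp only at h1
    rw [h1, h1]
    exact CPath.right_natCast_succ _ r
  have hstep : ∀ i r, 1 ≤ i → i + 1 ≤ lam.colLen 0 → r < n →
      p.toHalfPaths.lo (i + 1) (r + 1) < p.toHalfPaths.lo i (r + 1) →
      p.toHalfPaths.lo (i + 1) r < p.toHalfPaths.lo i (r + 1) := by
    intro i r hi hl hr h
    obtain ⟨k, rfl⟩ := Nat.exists_eq_add_of_le' hi
    exact hp.lo_step (i := ⟨k, by omega⟩) (j := ⟨k + 1, by omega⟩) (by simp) hr h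
  have ustep : ∀ i r, 1 ≤ i → i + 1 ≤ lam.colLen 0 → r < n →
      p.toHalfPaths.up (i + 1) (r + 1) < p.toHalfPaths.up i (r + 1) →
      p.toHalfPaths.up (i + 1) (r + 1) < p.toHalfPaths.up i r := by
    intro i r hi hl hr h
    obtain ⟨k, rfl⟩ := Nat.exists_eq_add_of_le' hi
    exact hp.up_step (i := ⟨k, by omega⟩) (j := ⟨k + 1, by omega⟩) (by simp) hr h
  have hlt : ∀ i r, 1 ≤ i → i + 1 ≤ lam.colLen 0 → r ≤ n →
      p.toHalfPaths.lo (i + 1) r < p.toHalfPaths.lo i r := by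
    intro i r hi hl hr
    induction hr using Nat.decreasingInduction with
    | self => exact hlast i hi hl
    | of_succ r hr ih => exact (hstep i r hi hl hr ih).trans_le (hmono i r hi (by omega) hr)
  have ult : ∀ i r, 1 ≤ i → i + 1 ≤ lam.colLen 0 → r ≤ n →
      p.toHalfPaths.up (i + 1) r < p.toHalfPaths.up i r := by
    intro i r hi hl hr
    induction hr using Nat.decreasingInduction with
    | self => exact ulast i hi hl
    | of_succ r hr ih => exact (umono (i + 1) r (by omega) hl hr).trans_lt (ustep i r hi hl hr ih)
  refine ⟨hmono, fun i r hi hl hr => hstep i r hi hl hr (hlt i (r + 1) hi hl hr), hlast, umono,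
    fun i r hi hl hr => ustep i r hi hl hr (ult i (r + 1) hi hl hr), ulast, fun i hi hl => ?_⟩
  obtain ⟨k, rfl⟩ := Nat.exists_eq_add_of_le' hi
  have h1 := p.lo_last ⟨k, by omega⟩
  have h2 := p.up_last ⟨k + (n + 1), by omega⟩
  have := rowLen_le_of_depth_le hd k
  simp only at h1 h2
  rw [show k + 1 + 1 + n = k + (n + 1) + 1 by ring, h1, h2]
  push_cast
  omega

end NoOrdinary

/-! ### Tuples with given positions -/

theorem exists_of_positions {A B : ℕ → ℕ → ℤ} (h : Noncrossing n (lam.colLen 0) A B)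
    {σ : Equiv.Perm (Fin (lam.colLen 0))}
    (hσ : Interlacing (fun i : Fin (lam.colLen 0) => A (i + 1) 0)
      (fun i : Fin (lam.colLen 0) => B (i + 1) 0) σ)
    (hA : ∀ i : Fin (lam.colLen 0), A (i + 1) n = (mu.rowLen i : ℤ) - (i : ℕ))
    (hB : ∀ i : Fin (lam.colLen 0), B (i + 1) n = (lam.rowLen i : ℤ) - (i : ℕ)) :
    ∃ p : PathTuple n lam mu, p.NoOrdinary ∧ p.perm = σ ∧
      (∀ i r, 1 ≤ i → i ≤ lam.colLen 0 → r ≤ n → p.toHalfPaths.lo i r = A i r) ∧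
      (∀ i r, 1 ≤ i → i ≤ lam.colLen 0 → r ≤ n → p.toHalfPaths.up i r = B i r) := by
  have hAm : ∀ (i : Fin (lam.colLen 0)) r, r < n → A (i + 1) (r + 1) ≤ A (i + 1) r :=
    fun i r hr => h.lo_mono _ r (by omega) i.2 hr
  have hBm : ∀ (i : Fin (lam.colLen 0)) r, r < n → B (i + 1) r ≤ B (i + 1) (r + 1) :=
    fun i r hr => h.up_mono _ r (by omega) i.2 hr
  let c : Fin (lam.colLen 0) → CPath n := fun i =>
    CPath.ofPositions (A (i + 1)) (B (σ i + 1)) (hσ.even i)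
  have hleft : ∀ i (r : ℕ), r ≤ n → (c i).left (-(r : ℤ)) = A (i + 1) r := fun i r hr =>
    CPath.ofPositions_left_neg (hσ.le i) (hAm i) (hBm (σ i)) hr
  have hright : ∀ i (r : ℕ), r ≤ n → (c i).right r = B (σ i + 1) r := fun i r hr =>
    CPath.ofPositions_right_natCast (hσ.le i) (hAm i) (hBm (σ i)) hr
  let p : PathTuple n lam mu :=
    { perm := σ
      path := c
      start_eq := fun i => by rw [← CPath.left_neg_last, hleft i n le_rfl, hA]
      end_eq := fun i => by rw [CPath.right_last, hright i n le_rfl, hB] }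
  have hlow : ∀ (i j : Fin (lam.colLen 0)) (r : ℕ) (x : ℤ), r ≤ n → i < j →
      (c i).Passes x (-(r : ℤ) - 1) → (c j).Passes x (-(r : ℤ) - 1) → False := by
    intro i j r x hr hij hi hj
    have h1 := hj.2.2.2
    have h2 := hi.2.2.1
    rw [← CPath.left_neg _ hr, hleft j r hr] at h1
    rcases hr.lt_or_eq with hr | rfl
    · rw [show -(r : ℤ) - 1 = -((r + 1 : ℕ) : ℤ) by push_cast; ring, hleft i (r + 1) hr] at h2
      have h3 := h.lo_lt (i + 1) r (by omega) (by omega) hr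
      have h4 := h.lo_anti hr.le (i := i + 1 + 1) (k := j + 1) (by omega) (by omega) j.2
      push_cast at h4
      omega
    · rw [LatticePath.left_bot, ← CPath.left_neg_last, hleft i _ le_rfl] at h2
      have h4 := h.lo_anti le_rfl (i := i + 1) (k := j + 1) (by omega) (by omega) j.2
      push_cast at h4
      omega
  have hupp : ∀ (i j : Fin (lam.colLen 0)) (r : ℕ) (x : ℤ), r ≤ n → σ i < σ j →
      (c i).Passes x ((r : ℤ) + 1) → (c j).Passes x ((r : ℤ) + 1) → False := by
    intro i j r x hr hij hi hj
    have h1 := hi.2.2.1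
    have h2 := hj.2.2.2
    rw [CPath.left_natCast_succ, hright i r hr] at h1
    rcases hr.lt_or_eq with hr | rfl
    · have h2 : x ≤ (c j).right ((r + 1 : ℕ) : ℤ) := by
        rw [Nat.cast_succ]
        exact h2
      rw [hright j (r + 1) hr] at h2
      have h3 := h.up_lt (σ i + 1) r (by omega) (by omega) hr
      have h4 := h.up_anti (r := r + 1) hr (i := σ i + 1 + 1) (k := σ j + 1) (by omega)
        (by omega) (σ j).2
      push_cast at h4
      omega
    · rw [CPath.right_last, hright j _ le_rfl] at h2
      have h4 := h.up_anti le_rfl (i := σ i + 1) (k := σ j + 1) (by omega) (by omega) (σ j).2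
      push_cast at h4
      omega
  have hzero : ∀ (i j : Fin (lam.colLen 0)) (x y : ℤ), i ≠ j → (c i).Passes x y →
      (c j).Passes x y → y = 0 := by
    intro i j x y hij hi hj
    by_contra hy
    rcases lt_or_gt_of_ne hy with hy | hy
    · have hb := hi.1
      obtain ⟨r, rfl⟩ : ∃ r : ℕ, y = -(r : ℤ) - 1 := ⟨(-y - 1).toNat, by omega⟩
      rcases lt_or_gt_of_ne hij with hij | hij
      · exact hlow i j r x (by omega) hij hi hj
      · exact hlow j i r x (by omega) hij hj hi
    · have ht := hi.2.1
      obtain ⟨r, rfl⟩ : ∃ r : ℕ, y = (r : ℤ) + 1 := ⟨(y - 1).toNat, by omega⟩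
      rcases lt_or_gt_of_ne fun h => hij (σ.injective h) with hij | hij
      · exact hupp i j r x (by omega) hij hi hj
      · exact hupp j i r x (by omega) hij hj hi
  refine ⟨p, ?_, rfl, ?_, ?_⟩
  · rintro i j hij ⟨hint, hns⟩
    refine hns ⟨hint, fun x y hi hj => hzero i j x y hij hi hj, ?_⟩
    obtain ⟨x, y, hi, hj⟩ := hint
    obtain rfl : y = 0 := hzero i j x y hij hi hj
    have hl : ∀ k, (c k).left 0 = A (k + 1) 0 := fun k => by
      simpa using hleft k 0 (Nat.zero_le n)
    have hr : ∀ k, (c k).right 0 = B (σ k + 1) 0 := fun k => by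
      simpa using hright k 0 (Nat.zero_le n)
    change Odd ((c i).left 0 - (c j).left 0)
    rw [← Int.not_even_iff_odd, hl, hl]
    intro he
    have h1 : (c i).left 0 ≤ x := hi.2.2.1
    have h2 : x ≤ (c i).right 0 := hi.2.2.2
    have h3 : (c j).left 0 ≤ x := hj.2.2.1
    have h4 : x ≤ (c j).right 0 := hj.2.2.2
    rw [hl] at h1 h3
    rw [hr] at h2 h4
    rcases hσ.disjoint i j hij he with h5 | h5 <;> omega
  · intro i r hi hl hr
    obtain ⟨k, rfl⟩ := Nat.exists_eq_add_of_le' hi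
    exact (p.lo_succ ⟨k, hl⟩ r).trans (hleft _ r hr)
  · intro i r hi hl hr
    obtain ⟨k, rfl⟩ := Nat.exists_eq_add_of_le' hi
    refine (p.up_succ ⟨k, hl⟩ r).trans ((hright _ r hr).trans ?_)
    change B ((σ (σ.symm ⟨k, hl⟩) : ℕ) + 1) r = _
    rw [Equiv.apply_symm_apply]

end PathTuple

/-! ### The involution -/

theorem Noncrossing.strictAnti_lo {n l : ℕ} {A B : ℕ → ℕ → ℤ} (h : Noncrossing n l A B) :
    StrictAnti fun i : Fin l => A (i + 1) 0 := by
  intro i j hij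
  have := h.lo_anti (Nat.zero_le n) (i := i + 1) (k := j + 1) (by omega) (by omega) j.2
  push_cast at this
  simp only
  omega

theorem Noncrossing.strictAnti_up {n l : ℕ} {A B : ℕ → ℕ → ℤ} (h : Noncrossing n l A B) :
    StrictAnti fun i : Fin l => B (i + 1) 0 := by
  intro i j hij
  have := h.up_anti (Nat.zero_le n) (i := i + 1) (k := j + 1) (by omega) (by omega) j.2
  push_cast at this
  simp only
  omega

namespace HalfPaths

variable {n l : ℕ} {q : HalfPaths n l} {V : Set LatticeUnit}

theorem exchange_zero (q : HalfPaths n l) (V : Set LatticeUnit) :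
    Exchange l (fun k => q.lo (k + 1) 0) (fun k => q.up (k + 1) 0) (fun k => q.newLo V (k + 1) 0)
      (fun k => q.newUp V (k + 1) 0) (fun k => q.Swapped V (k + 1) 0) where
  lt_of_mem k hk := by
    have := hk.2.1
    omega
  left_of_mem k hk := by
    rw [newLo, if_pos hk, dual]
    simp
  left_of_not_mem k _ hk := if_neg hk
  right_of_mem k hk := by
    have := q.newUp_add V (k + 1) 0
    rw [newDual, if_pos hk] at this
    simpa using this
  right_of_not_mem k _ hk := by
    have := q.newUp_add V (k + 1) 0
    rw [newDual, if_neg hk, dual] at this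
    simpa using this
  right_zero _ := q.newUp_of_le V le_rfl

theorem IsRegion.color (hV : q.IsRegion V) (hq : q.IsNoncrossing) :
    (∀ k, q.Swapped V (k + 1) 0 → q.lo (k + 1) 0 ≤ q.up (k + 1 + 1) 0 + 1) ∨
      ∀ k, q.Swapped V (k + 1) 0 → q.up (k + 1 + 1) 0 + 1 ≤ q.lo (k + 1) 0 := by
  have hdual : ∀ k, q.dual (k + 1) 0 = q.up (k + 1 + 1) 0 + 1 := by
    intro k
    rw [dual]
    simp
  rcases hV.subset_or q hq with h | h
  · left
    rintro k ⟨h1, hl, h2, x, hxV, hx | hx⟩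
    · rw [hdual] at hx
      omega
    · exfalso
      refine q.disjoint_units hq (h hxV) ⟨k + 1, by omega, ?_⟩
      rw [iiUnitAt_lower _ (by omega)]
      exact ⟨h2, fun _ => hx.1, fun _ => hx.2⟩
  · right
    rintro k ⟨h1, hl, h2, x, hxV, hx | hx⟩
    · exfalso
      refine q.disjoint_units hq ⟨k + 1, by omega, ?_⟩ (h hxV)
      rw [iUnitAt_lower _ (by omega)]
      exact ⟨h2, h1, hl, hx⟩
    · rw [hdual] at hx
      omega

theorem IsRegion.ncard_evenGaps (hV : q.IsRegion V) : (q.evenGaps V).ncard =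
    {k | q.Swapped V (k + 1) 0 ∧ Even (q.lo (k + 1) 0 - q.up (k + 1 + 1) 0)}.ncard := by
  rw [← Set.ncard_image_of_injective {k | _} (add_left_injective 1)]
  congr 1
  ext i
  rw [hV.mem_evenGaps_iff]
  constructor
  · intro h
    obtain ⟨k, rfl⟩ := Nat.exists_eq_add_of_le' h.1.1
    exact ⟨k, h, rfl⟩
  · rintro ⟨k, h, rfl⟩
    exact h

end HalfPaths

variable {n : ℕ} {lam mu : YoungDiagram}

theorem exists_isSwap (hd : depth lam mu ≤ n + 1) {p : PathTuple n lam mu} (hp : p.NoOrdinary)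
    {V : Set LatticeUnit} (hV : V ∈ p.toHalfPaths.oddRegions) :
    ∃ p' : PathTuple n lam mu, p'.NoOrdinary ∧ p'.sign = -p.sign ∧
      HalfPaths.IsSwap p.toHalfPaths p'.toHalfPaths V := by
  have hq := hp.isNoncrossing hd
  have hq' := hV.1.noncrossing hq
  have hI := hp.interlacing hq.strictAnti_lo hq.strictAnti_up
  have hex := p.toHalfPaths.exchange_zero V
  obtain ⟨σ, hσ⟩ := exists_interlacing (A := fun k => p.toHalfPaths.newLo V (k + 1) 0)
    (B := fun k => p.toHalfPaths.newUp V (k + 1) 0) hq'.strictAnti_lo hq'.strictAnti_up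
    (hex.coverCount_mem
      (fun i k hik hk => hq.strictAnti_lo (a := ⟨i, hik.trans hk⟩) (b := ⟨k, hk⟩) hik)
      (fun i k hik hk => hq.strictAnti_up (a := ⟨i, hik.trans hk⟩) (b := ⟨k, hk⟩) hik)
      (Interlacing.coverCount_mem (A := fun k => p.toHalfPaths.lo (k + 1) 0)
        (B := fun k => p.toHalfPaths.up (k + 1) 0) hI) (hV.1.color hq))
  obtain ⟨p', hp', rfl, hlo, hup⟩ := PathTuple.exists_of_positions hq' hσ
    (fun i => by rw [HalfPaths.newLo_last hV.1 hq, p.lo_last])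
    (fun i => by rw [HalfPaths.newUp_last hV.1 hq, p.up_last])
  refine ⟨p', hp', hex.sign_eq hI hσ ?_, hlo, hup⟩
  rw [← hV.1.ncard_evenGaps]
  exact hV.2

/-- An odd region chosen only in terms of the set of odd regions. -/
def chosenRegion (R : Set (Set LatticeUnit)) : Set LatticeUnit := Classical.epsilon (· ∈ R)

end TypeC

end

theorem mainTheorem5 (n : ℕ) (hn : 1 ≤ n) (lam mu : YoungDiagram) (hmu : mu ≤ lam)
    (hpos : TypeC.depth lam mu ≤ n + 1) :
    ∃ ι : TypeC.POdd n lam mu → TypeC.POdd n lam mu,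
      Function.Involutive ι ∧
      (∀ (p : TypeC.POdd n lam mu) (a : ℂ), (ι p).1.weight a = p.1.weight a) ∧
      (∀ p : TypeC.POdd n lam mu, (ι p).1.sign = - p.1.sign) := by
  have hex : ∀ p : TypeC.POdd n lam mu, ∃ p' : TypeC.POdd n lam mu, p'.1.sign = -p.1.sign ∧
      TypeC.HalfPaths.IsSwap p.1.toHalfPaths p'.1.toHalfPaths
        (TypeC.chosenRegion p.1.toHalfPaths.oddRegions) := by
    rintro ⟨p, hp, hodd⟩
    have hq := TypeC.PathTuple.NoOrdinary.isNoncrossing hp hpos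
    have hV : TypeC.chosenRegion p.toHalfPaths.oddRegions ∈ p.toHalfPaths.oddRegions :=
      Classical.epsilon_spec ((p.toHalfPaths.hasOddRegion_iff hq).1 hodd)
    obtain ⟨p', hp', hsign, hswap⟩ := TypeC.exists_isSwap hpos hp hV
    refine ⟨⟨p', hp', ?_⟩, hsign, hswap⟩
    rw [TypeC.HalfPaths.hasOddRegion_iff _ (hswap.isNoncrossing hV.1 hq),
      hswap.oddRegions_eq hV.1 hq]
    exact ⟨_, hV⟩
  choose ι hsign hswap using hex
  refine ⟨ι, fun p => ?_, fun p a => ?_, hsign⟩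
  · have hq := TypeC.PathTuple.NoOrdinary.isNoncrossing p.2.1 hpos
    have hq' := TypeC.PathTuple.NoOrdinary.isNoncrossing (ι (ι p)).2.1 hpos
    have hV : TypeC.chosenRegion p.1.toHalfPaths.oddRegions ∈ p.1.toHalfPaths.oddRegions :=
      Classical.epsilon_spec ((p.1.toHalfPaths.hasOddRegion_iff hq).1 p.2.2)
    have h1 := hswap p
    have h2 := hswap (ι p)
    rw [h1.oddRegions_eq hV.1 hq] at h2
    have hlo := fun i r => h1.lo_eq_of_isSwap h2 (i := i) (r := r)
    have hup := fun i r => h1.up_eq_of_isSwap h2 (i := i) (r := r)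
    have hI := TypeC.PathTuple.NoOrdinary.interlacing p.2.1 hq.strictAnti_lo hq.strictAnti_up
    have hI' := TypeC.PathTuple.NoOrdinary.interlacing (ι (ι p)).2.1 hq'.strictAnti_lo
      hq'.strictAnti_up
    refine Subtype.ext (TypeC.PathTuple.ext_positions ?_ hlo hup)
    simp only [hlo _ 0 (Nat.succ_pos _) (Fin.is_lt _) (Nat.zero_le n),
      hup _ 0 (Nat.succ_pos _) (Fin.is_lt _) (Nat.zero_le n)] at hI'
    exact hI'.unique hI
  · rw [TypeC.PathTuple.weight_eq (TypeC.unitSteps n a),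
      TypeC.PathTuple.weight_eq (TypeC.unitSteps n a),
      TypeC.HalfPaths.IsSwap.posWeight_eq _ (hswap p)]
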